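/- Let $G\le SO(n)$ be a compact subgroup, and let $V=\mathbb{C}^k$, $W=\mathbb{C}^l$ be equipped with continuous linear actions $g\mapsto g^V$, $g\mapsto g^W$ of $G$. Fix $g\in G$, let $(\mathbb{R}^n)^g$ be the fixed-point subspace of $g$, let $n_g\ge 0$ be its dimension, and let $x_1,\dots,x_{n_g}$ be the linear coordinates along an orthonormal basis $v_1,\dots,v_{n_g}$ of $(\mathbb{R}^n)^g$, so that $x_j(x)=\langle v_j,x\rangle$ and $\partial_{x_j}$ is the derivative in the direction $v_j$ on $\mathbb{R}^n$ (for instance the first $n_g$ standard coordinates, when these span $(\mathbb{R}^n)^g$). For a finite-dimensional complex inner product space $F$ with an action of $G$ let $\hat g$ be the operator $(\hat g\varphi)(x)=g\cdot\varphi(g^{-1}x)$ on $L^2(\mathbb{R}^n;F)$; let $\mathcal{K}^\infty(L^2(\mathbb{R}^n;F))$ be the algebra of integral operators on $L^2(\mathbb{R}^n;F)$ with kernels in $\mathcal{S}(\mathbb{R}^n\times\mathbb{R}^n;\mathrm{End}(F))$, and let $(\mathcal{K}^\infty(L^2(\mathbb{R}^n;F)))^g$ be the set of $T\in\mathcal{K}^\infty(L^2(\mathbb{R}^n;F))$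 with $\hat gT=T\hat g$. Let $\delta_{2j-1}(S)=[\partial_{x_j},S]$ and $\delta_{2j}(S)=[x_j,S]$ for $1\le j\le n_g$, and define on $(\mathcal{K}^\infty(L^2(\mathbb{R}^n;F)))^g$ $$\omega_g(T_0,\dots,T_{2n_g})=\frac{(-1)^{n_g}}{n_g!}\sum_{\sigma\in S_{2n_g}}\mathrm{sgn}(\sigma)\,\mathrm{Tr}\bigl(\hat g\,T_0\,\delta_{\sigma(1)}(T_1)\cdots\delta_{\sigma(2n_g)}(T_{2n_g})\bigr),$$ so that $\omega_g(T)=\mathrm{Tr}(\hat gT)$ if $n_g=0$. The pairing of the class of an idempotent matrix $e$ over an algebra $A$ with the class of a cyclic $2l$-cocycle $\phi$ on $A$ is $\langle[e],[\phi]\rangle=(2\pi i)^{-l}(l!)^{-1}(\phi\#\mathrm{tr})(e,\dots,e)$, where $(\phi\#\mathrm{tr})(e,\dots,e)=\sum_{k_0,\dots,k_{2l}}\phi(e_{k_0k_1},e_{k_1k_2},\dots,e_{k_{2l}k_0})$. Then: (1) for $F=\mathbb{C}$ with the trivial action and every idempotent $T\in(\mathcal{K}^\infty(L^2(\mathbb{R}^n)))^g$,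 $$\langle[T],[(2\pi i)^{n_g}\,n_g!\,\omega_g]\rangle=\mathrm{Tr}(\hat gT);$$ (2) for $F=V\oplus W$ with the action $g^V\oplus g^W$ and every idempotent $T\in(\mathcal{K}^\infty(L^2(\mathbb{R}^n;V\oplus W)))^g$, $$\langle[T],[(2\pi i)^{n_g}\,n_g!\,\omega_g]\rangle=\mathrm{Tr}(\hat gT).$$ -/

import Mathlib

open MeasureTheory
open scoped SchwartzMap LineDeriv InnerProductSpace ENNReal

noncomputable section

namespace TwistedPairing

/-! ### Traces of operators on a Hilbert space -/

section HilbertTrace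

variable {H : Type*} [NormedAddCommGroup H] [InnerProductSpace ℂ H]

/-- Trace-class (nuclear) operators: `A = ∑ₖ ⟨aₖ, ·⟩ bₖ` with `∑ₖ ‖aₖ‖ ‖bₖ‖ < ∞`. -/
def IsTraceClass (A : H →L[ℂ] H) : Prop :=
  ∃ a b : ℕ → H, Summable (fun k => ‖a k‖ * ‖b k‖) ∧
    ∀ x : H, HasSum (fun k => ⟪a k, x⟫_ℂ • b k) (A x)

/-- The canonical trace `∑ᵢ ⟨eᵢ, A eᵢ⟩`, for a Hilbert basis `e` of `H`. For a trace-class `A` the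
choice of `e` does not matter, see `hasSum_opTrace`. -/
def opTrace [CompleteSpace H] (A : H →L[ℂ] H) : ℂ :=
  ∑' i, ⟪(exists_hilbertBasis ℂ H).choose_spec.choose i,
    A ((exists_hilbertBasis ℂ H).choose_spec.choose i)⟫_ℂ

theorem hasSum_trace_of_nuclear {A : H →L[ℂ] H} {a b : ℕ → H}
    (hab : Summable (fun k => ‖a k‖ * ‖b k‖))
    (hsum : ∀ x : H, HasSum (fun k => ⟪a k, x⟫_ℂ • b k) (A x))
    {ι : Type*} (e : HilbertBasis ι ℂ H) :
    HasSum (fun i => ⟪e i, A (e i)⟫_ℂ) (∑' k, ⟪a k, b k⟫_ℂ) := by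
  have hsq : ∀ x : H, HasSum (fun i => ‖⟪e i, x⟫_ℂ‖ ^ 2) (‖x‖ ^ 2) := by
    intro x
    have h := (e.hasSum_inner_mul_inner x x).mapL Complex.reCLM
    have h2 : Complex.reCLM ⟪x, x⟫_ℂ = ‖x‖ ^ 2 := by
      simpa using (inner_self_eq_norm_sq (𝕜 := ℂ) x)
    rw [h2] at h
    convert h using 2 with i
    rw [← inner_conj_symm x (e i), ← Complex.normSq_eq_conj_mul_self, Complex.normSq_eq_norm_sq]
    exact (Complex.ofReal_re _).symm
  have hbd : ∀ k, Summable (fun i => ‖⟪a k, e i⟫_ℂ * ⟪e i, b k⟫_ℂ‖) ∧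
      ∑' i, ‖⟪a k, e i⟫_ℂ * ⟪e i, b k⟫_ℂ‖ ≤ ‖a k‖ * ‖b k‖ := by
    intro k
    have hS := Real.summable_mul_of_Lp_Lq_of_nonneg (p := 2) (q := 2)
      (f := fun i => ‖⟪e i, a k⟫_ℂ‖) (g := fun i => ‖⟪e i, b k⟫_ℂ‖)
      Real.HolderConjugate.two_two (fun _ => norm_nonneg _) (fun _ => norm_nonneg _)
      (by simpa using (hsq (a k)).summable) (by simpa using (hsq (b k)).summable)
    have hL := Real.inner_le_Lp_mul_Lq_tsum_of_nonneg (p := 2) (q := 2)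
      (f := fun i => ‖⟪e i, a k⟫_ℂ‖) (g := fun i => ‖⟪e i, b k⟫_ℂ‖)
      Real.HolderConjugate.two_two (fun _ => norm_nonneg _) (fun _ => norm_nonneg _)
      (by simpa using (hsq (a k)).summable) (by simpa using (hsq (b k)).summable)
    have h1 : ∑' i, ‖⟪e i, a k⟫_ℂ‖ ^ (2 : ℝ) = ‖a k‖ ^ 2 := by
      simpa using (hsq (a k)).tsum_eq
    have h2 : ∑' i, ‖⟪e i, b k⟫_ℂ‖ ^ (2 : ℝ) = ‖b k‖ ^ 2 := by
      simpa using (hsq (b k)).tsum_eq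
    rw [h1, h2, ← Real.sqrt_eq_rpow, ← Real.sqrt_eq_rpow, Real.sqrt_sq (norm_nonneg _),
      Real.sqrt_sq (norm_nonneg _)] at hL
    have hn : ∀ i, ‖⟪a k, e i⟫_ℂ * ⟪e i, b k⟫_ℂ‖ = ‖⟪e i, a k⟫_ℂ‖ * ‖⟪e i, b k⟫_ℂ‖ := by
      intro i
      rw [norm_mul, norm_inner_symm]
    simp only [hn]
    exact ⟨hS, hL⟩
  have hprod : Summable (fun p : ℕ × ι => ⟪a p.1, e p.2⟫_ℂ * ⟪e p.2, b p.1⟫_ℂ) := by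
    apply Summable.of_norm
    refine (summable_prod_of_nonneg (fun _ => norm_nonneg _)).2 ⟨fun k => (hbd k).1, ?_⟩
    exact Summable.of_nonneg_of_le (fun k => tsum_nonneg fun _ => norm_nonneg _)
      (fun k => (hbd k).2) hab
  have hval : HasSum (fun p : ℕ × ι => ⟪a p.1, e p.2⟫_ℂ * ⟪e p.2, b p.1⟫_ℂ)
      (∑' k, ⟪a k, b k⟫_ℂ) := by
    have h := hprod.hasSum.prod_fiberwise fun k => e.hasSum_inner_mul_inner (a k) (b k)
    rw [h.tsum_eq]
    exact hprod.hasSum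
  have hswap := ((Equiv.prodComm ι ℕ).hasSum_iff).2 hval
  refine hswap.prod_fiberwise fun i => ?_
  have h := (hsum (e i)).mapL (innerSL ℂ (e i))
  simpa [inner_smul_right] using h

/-- The trace of a trace-class operator can be computed in every Hilbert basis. -/
theorem hasSum_opTrace [CompleteSpace H] {A : H →L[ℂ] H} (hA : IsTraceClass A)
    {ι : Type*} (e : HilbertBasis ι ℂ H) :
    HasSum (fun i => ⟪e i, A (e i)⟫_ℂ) (opTrace A) := by
  obtain ⟨a, b, hab, hsum⟩ := hA
  have h := hasSum_trace_of_nuclear hab hsum (exists_hilbertBasis ℂ H).choose_spec.choose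
  rw [opTrace, h.tsum_eq]
  exact hasSum_trace_of_nuclear hab hsum e

end HilbertTrace

/-! ### Schwartz-kernel operators on `L²(ℝⁿ; F)` and their derivations -/

/-- Euclidean space `ℝⁿ`. -/
abbrev Euc (n : ℕ) : Type := EuclideanSpace ℝ (Fin n)

/-- The Hilbert space `L²(ℝⁿ; F)`. -/
abbrev L2 (n : ℕ) (F : Type*) [NormedAddCommGroup F] : Type _ :=
  Lp F 2 (volume : Measure (Euc n))

section Operators

variable {n : ℕ} {F : Type*} [NormedAddCommGroup F] [InnerProductSpace ℂ F]

/-- `T` is the integral operator on `L²(ℝⁿ; F)` of a kernel in `𝓢(ℝⁿ × ℝⁿ; End F)`; these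
operators form the algebra `𝒦^∞`. -/
def IsSchwartzKernelOperator (T : L2 n F →L[ℂ] L2 n F) : Prop :=
  ∃ K : 𝓢(Euc n × Euc n, F →L[ℂ] F), ∀ f : L2 n F,
    (T f : Euc n → F) =ᵐ[volume] fun x => ∫ y, K (x, y) (f y)

/-- The directional derivative `∂_v` on Schwartz functions. -/
def partialOp (v : Euc n) : 𝓢(Euc n, F) →L[ℂ] 𝓢(Euc n, F) :=
  LineDeriv.lineDerivOpCLM ℂ 𝓢(Euc n, F) v

/-- Multiplication by the linear coordinate `x ↦ ⟨v, x⟩` on Schwartz functions. -/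
def coordOp (v : Euc n) : 𝓢(Euc n, F) →L[ℂ] 𝓢(Euc n, F) :=
  SchwartzMap.smulLeftCLM F (fun x : Euc n => ((⟪v, x⟫_ℝ : ℝ) : ℂ))

theorem partialOp_apply (v : Euc n) (φ : 𝓢(Euc n, F)) (x : Euc n) :
    partialOp v φ x = lineDeriv ℝ φ x v := by
  exact SchwartzMap.lineDerivOp_apply v φ x

theorem coordOp_apply (v : Euc n) (φ : 𝓢(Euc n, F)) (x : Euc n) :
    coordOp v φ x = ((⟪v, x⟫_ℝ : ℝ) : ℂ) • φ x := by
  refine SchwartzMap.smulLeftCLM_apply_apply ?_ φ x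
  exact Complex.ofRealCLM.hasTemperateGrowth.comp (innerSL ℝ v).hasTemperateGrowth

/-- The bounded operator `R` on `L²` is the commutator `[D, S]`: on the dense subspace of Schwartz
functions, which `S` has to preserve, `R φ = D (S φ) - S (D φ)`. -/
def IsCommutator (D : 𝓢(Euc n, F) →L[ℂ] 𝓢(Euc n, F)) (S R : L2 n F →L[ℂ] L2 n F) : Prop :=
  ∀ φ : 𝓢(Euc n, F), ∃ ψ : 𝓢(Euc n, F), S (φ.toLp 2 volume) = ψ.toLp 2 volume ∧
    R (φ.toLp 2 volume) = (D ψ).toLp 2 volume - S ((D φ).toLp 2 volume)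

theorem IsCommutator.unique {D : 𝓢(Euc n, F) →L[ℂ] 𝓢(Euc n, F)} {S R R' : L2 n F →L[ℂ] L2 n F}
    (h : IsCommutator D S R) (h' : IsCommutator D S R') : R = R' := by
  have hd : DenseRange (SchwartzMap.toLpCLM ℝ F 2 (volume : Measure (Euc n))) :=
    SchwartzMap.denseRange_toLpCLM (by norm_num)
  refine DFunLike.coe_injective (hd.equalizer R.continuous R'.continuous ?_)
  funext φ
  obtain ⟨ψ, h1, h2⟩ := h φ
  obtain ⟨ψ', h1', h2'⟩ := h' φ
  have hψ : ψ = ψ' := SchwartzMap.injective_toLp 2 volume (h1.symm.trans h1')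
  subst hψ
  exact h2.trans h2'.symm

open Classical in
/-- The commutator `[D, S]` as a bounded operator on `L²(ℝⁿ; F)`. -/
def commutator (D : 𝓢(Euc n, F) →L[ℂ] 𝓢(Euc n, F)) (S : L2 n F →L[ℂ] L2 n F) :
    L2 n F →L[ℂ] L2 n F :=
  if h : ∃ R, IsCommutator D S R then h.choose else 0

theorem IsCommutator.commutator_eq {D : 𝓢(Euc n, F) →L[ℂ] 𝓢(Euc n, F)}
    {S R : L2 n F →L[ℂ] L2 n F} (h : IsCommutator D S R) : commutator D S = R := by
  have hex : ∃ R, IsCommutator D S R := ⟨R, h⟩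
  rw [commutator, dif_pos hex]
  exact hex.choose_spec.unique h

/-- The derivations attached to the coordinates along `v₀, …, v_{m-1}`, numbered from `0`:
the one with index `2j` is `[∂_{v_j}, ·]` and the one with index `2j + 1` is `[⟨v_j, x⟩, ·]`. -/
def delta {m : ℕ} (v : Fin m → Euc n) (i : Fin (2 * m)) (S : L2 n F →L[ℂ] L2 n F) :
    L2 n F →L[ℂ] L2 n F :=
  if (i : ℕ) % 2 = 0 then commutator (partialOp (v ⟨(i : ℕ) / 2, by omega⟩)) S
  else commutator (coordOp (v ⟨(i : ℕ) / 2, by omega⟩)) S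

/-! ### The group action -/

/-- The isometry `x ↦ g x` of `ℝⁿ` given by `g ∈ SO(n)`. -/
def rotation (g : Matrix.specialOrthogonalGroup (Fin n) ℝ) : Euc n ≃ₗᵢ[ℝ] Euc n :=
  Unitary.linearIsometryEquiv ⟨Matrix.toEuclideanCLM (n := Fin n) (𝕜 := ℝ) g.1, by
    have h : g.1 ∈ unitary (Matrix (Fin n) (Fin n) ℝ) :=
      (Matrix.mem_specialOrthogonalGroup_iff.1 g.2).1
    exact ⟨by rw [← map_star, ← map_mul, h.1, map_one],
      by rw [← map_star, ← map_mul, h.2, map_one]⟩⟩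

theorem rotation_apply (g : Matrix.specialOrthogonalGroup (Fin n) ℝ) (x : Euc n) (i : Fin n) :
    rotation g x i = ∑ j, g.1 i j * x j := by
  simp [rotation, Unitary.linearIsometryEquiv, Matrix.mulVec, dotProduct]

/-- The fixed-point subspace `(ℝⁿ)^g`. -/
def fixedSpace (g : Matrix.specialOrthogonalGroup (Fin n) ℝ) : Submodule ℝ (Euc n) where
  carrier := {x | rotation g x = x}
  add_mem' := by
    intro a b ha hb
    simp only [Set.mem_ofPred_eq] at *
    rw [map_add, ha, hb]
  zero_mem' := by simp
  smul_mem' := by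
    intro c a ha
    simp only [Set.mem_ofPred_eq] at *
    rw [map_smul, ha]

/-- The operator `(ĝ φ)(x) = h (φ (g⁻¹ x))` on `L²(ℝⁿ; F)`, where `h` is the action of `g`
on `F`. -/
def gHat (g : Matrix.specialOrthogonalGroup (Fin n) ℝ) (h : F →L[ℂ] F) : L2 n F →L[ℂ] L2 n F :=
  (h.compLpL 2 volume).comp
    (Lp.compMeasurePreservingₗᵢ ℂ (rotation g).symm
      (rotation g).symm.measurePreserving).toContinuousLinearMap

theorem gHat_ae_eq (g : Matrix.specialOrthogonalGroup (Fin n) ℝ) (h : F →L[ℂ] F) (f : L2 n F) :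
    (gHat g h f : Euc n → F) =ᵐ[volume] fun x => h (f ((rotation g).symm x)) := by
  have h1 := ContinuousLinearMap.coeFn_compLpL (p := 2) (μ := (volume : Measure (Euc n))) h
    (Lp.compMeasurePreserving (rotation g).symm (rotation g).symm.measurePreserving f)
  have h2 := Lp.coeFn_compMeasurePreserving f (rotation g).symm.measurePreserving
  filter_upwards [h1, h2] with x hx hx'
  rw [Function.comp_apply] at hx'
  rw [← hx', ← hx]
  rfl

/-- The set `(𝒦^∞)^g` of Schwartz-kernel operators on `L²(ℝⁿ; F)` that commute with `ĝ`. -/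
def invariantKernelOps (g : Matrix.specialOrthogonalGroup (Fin n) ℝ) (h : F →L[ℂ] F) :
    Set (L2 n F →L[ℂ] L2 n F) :=
  {T | IsSchwartzKernelOperator T ∧ gHat g h * T = T * gHat g h}

/-! ### The twisted cocycle and the pairing -/

/-- The `g`-twisted `2m`-cochain on `(𝒦^∞)^g`:
`ω_g(T₀, …, T_{2m}) = ((-1)^m / m!) ∑_σ sgn(σ) Tr(ĝ T₀ δ_{σ(1)}(T₁) ⋯ δ_{σ(2m)}(T_{2m}))`,
where `v₀, …, v_{m-1}` is an orthonormal basis of the fixed-point subspace of `g`. -/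
def omega [CompleteSpace F] (g : Matrix.specialOrthogonalGroup (Fin n) ℝ) (h : F →L[ℂ] F) {m : ℕ}
    (v : OrthonormalBasis (Fin m) ℝ (fixedSpace g))
    (T : Fin (2 * m + 1) → invariantKernelOps g h) : ℂ :=
  (-1) ^ m / (m.factorial : ℂ) * ∑ σ : Equiv.Perm (Fin (2 * m)),
    ((Equiv.Perm.sign σ : ℤ) : ℂ) *
      opTrace (gHat g h * (T 0).1 *
        (List.ofFn fun i : Fin (2 * m) =>
          delta (fun j => (v j : Euc n)) (σ i) (T i.succ).1).prod)

end Operators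

/-- The pairing of the class of an idempotent matrix `e ∈ M_N(A)` with the class of a cyclic
`2l`-cocycle `φ` on `A`, namely `(2πi)^{-l} (l!)⁻¹ (φ # tr)(e, …, e)`, where
`(φ # tr)(e, …, e) = ∑ φ(e_{k₀ k₁}, e_{k₁ k₂}, …, e_{k_{2l} k₀})` over all `k₀, …, k_{2l}`. -/
def pairing {A : Type*} {N : ℕ} (l : ℕ) (e : Matrix (Fin N) (Fin N) A)
    (φ : (Fin (2 * l + 1) → A) → ℂ) : ℂ :=
  ((2 * Real.pi * Complex.I) ^ l)⁻¹ * (l.factorial : ℂ)⁻¹ *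
    ∑ k : Fin (2 * l + 1) → Fin N, φ fun i => e (k i) (k (i + 1))

/-- The operator `diag(S, R)` on `V ⊕ W`. -/
def blockDiag {V W : Type*} [NormedAddCommGroup V] [InnerProductSpace ℂ V]
    [NormedAddCommGroup W] [InnerProductSpace ℂ W] (S : V →L[ℂ] V) (R : W →L[ℂ] W) :
    WithLp 2 (V × W) →L[ℂ] WithLp 2 (V × W) :=
  ((WithLp.prodContinuousLinearEquiv 2 ℂ V W).symm : V × W →L[ℂ] WithLp 2 (V × W)).comp
    ((S.prodMap R).comp
      (WithLp.prodContinuousLinearEquiv 2 ℂ V W : WithLp 2 (V × W) →L[ℂ] V × W))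

end TwistedPairing

end

open TwistedPairing

namespace TwistedPairing

/-! ### Noncommutative algebra: the alternating sum computed in an exterior algebra -/

section Algebra

open scoped TensorProduct

/-! Write `D_a` for the operators `∂_{v_j}`, `⟨v_j, x⟩` and `d_a = [D_a, T]`. The claim reduces to
evaluating the alternating trace at an idempotent `T`, which is a Heisenberg-relation computation.

Put `A_a = T D_a T`. From `T² = T` one gets `d_a d_b T = A_a A_b - T D_a D_b T`. Let `e_a` be
exterior generators and set `d = ∑ e_a ⊗ d_a`, `A = ∑ e_a ⊗ A_a`. Antisymmetrising, the canonical
commutation relations turn the last term into a multiple of `T`, so `d² T = (A² - Ω) T` with `Ω = ∑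
e_{2j} e_{2j+1}`. Hence `d^{2m} T = (A² - Ω)^m T`. The alternating sum is the top coefficient of the
trace of this. Every contribution containing `A` is the trace of a supercommutator and vanishes,
because `A` commutes with `ĝ` and `T`. What remains is `(-Ω)^m`, whose top coefficient is `(-1)^m
m!`, exactly cancelling the prefactor of `omega`. This is `sum_sign_trace_prod`.

The analysis makes these products legitimate. An idempotent with Schwartz kernel has
finite-dimensional range (`finiteDimensional_range_of_isIdempotentElem`) consisting of Schwartz
functions, so `D T` and `T D` are bounded, and all traces live on that range
(`opTrace_eq_compressedTrace`). Since the `v_j` are fixed by `g`, `ĝ` commutes with each `D_a`. -/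

theorem sum_pow_eq_sum_prod_ofFn {ι Q : Type*} [Fintype ι] [Semiring Q] (c : ι → Q) (n : ℕ) :
    (∑ i, c i) ^ n = ∑ p : Fin n → ι, (List.ofFn fun i => c (p i)).prod := by
  induction n with
  | zero => simp
  | succ n ih =>
    rw [pow_succ', ih, Finset.sum_mul_sum, ← Fintype.sum_prod_type']
    refine Fintype.sum_equiv (Fin.consEquiv fun _ => ι) _ _ fun p => ?_
    simp [Fin.consEquiv]

theorem tmul_prod_ofFn {A B : Type*} [Ring A] [Algebra ℂ A] [Ring B] [Algebra ℂ B] (n : ℕ)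
    (x : Fin n → A) (y : Fin n → B) :
    (List.ofFn fun i => x i ⊗ₜ[ℂ] y i).prod
      = (List.ofFn x).prod ⊗ₜ[ℂ] (List.ofFn y).prod := by
  induction n with
  | zero => simp [Algebra.TensorProduct.one_def]
  | succ n ih => simp [List.ofFn_succ, ih]

theorem add_pow_succ_of_sq_eq_zero {Q : Type*} [Ring Q] {s u : Q} (h : Commute s u)
    (hu : u * u = 0) (n : ℕ) : (s + u) ^ (n + 1) = s ^ (n + 1) + (n + 1) • (s ^ n * u) := by
  induction n with
  | zero => simp
  | succ n ih =>
    have h1 : s ^ n * u * s = s ^ (n + 1) * u := by rw [mul_assoc, ← h.eq, ← mul_assoc, ← pow_succ]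
    have h2 : s ^ n * u * u = 0 := by rw [mul_assoc, hu, mul_zero]
    rw [pow_succ, ih, add_mul, mul_add, mul_add, smul_mul_assoc, smul_mul_assoc, h1, h2, smul_zero,
      add_zero, ← pow_succ, add_assoc, ← succ_nsmul']

/-- Only squarefree words survive, each arising in `k!` orders. The vanishing of the next power is
carried along because the induction step produces that term. -/
theorem sum_range_pow_of_sq_eq_zero {Q : Type*} [Ring Q] (u : ℕ → Q)
    (hc : ∀ i j, Commute (u i) (u j)) (hu : ∀ i, u i * u i = 0) (k : ℕ) :
    (∑ j ∈ Finset.range k, u j) ^ k = k.factorial • ((List.range k).map u).prod ∧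
      (∑ j ∈ Finset.range k, u j) ^ (k + 1) = 0 := by
  induction k with
  | zero => simp
  | succ k ih =>
    have h : Commute (∑ j ∈ Finset.range k, u j) (u k) := Commute.sum_left _ _ _ fun i _ => hc i k
    rw [Finset.sum_range_succ, add_pow_succ_of_sq_eq_zero h (hu k),
      add_pow_succ_of_sq_eq_zero h (hu k), pow_succ _ (k + 1), ih.1, ih.2]
    simp [List.range_succ, Nat.factorial_succ, mul_smul, mul_assoc]

theorem sum_range_two_mul {M : Type*} [AddCommMonoid M] (f : ℕ → M) (m : ℕ) :
    ∑ i ∈ Finset.range (2 * m), f i = ∑ j ∈ Finset.range m, (f (2 * j) + f (2 * j + 1)) := by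
  induction m with
  | zero => simp
  | succ m ih =>
    rw [show 2 * (m + 1) = 2 * m + 1 + 1 by ring, Finset.sum_range_succ, Finset.sum_range_succ, ih,
      Finset.sum_range_succ, add_assoc]

theorem prod_map_range_two_mul {M : Type*} [Monoid M] (f : ℕ → M) (m : ℕ) :
    ((List.range (2 * m)).map f).prod
      = ((List.range m).map fun j => f (2 * j) * f (2 * j + 1)).prod := by
  induction m with
  | zero => simp
  | succ m ih =>
    rw [show 2 * (m + 1) = 2 * m + 1 + 1 by ring, List.range_succ, List.range_succ,
      List.range_succ (n := m)]
    simp [ih]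

/-- The generators of the exterior algebra of `ℂᴺ`, numbered by `ℕ` and extended by zero. -/
noncomputable def extGen (N k : ℕ) : ExteriorAlgebra ℂ (Fin N → ℂ) :=
  if h : k < N then ExteriorAlgebra.ι ℂ (Pi.single ⟨k, h⟩ 1) else 0

theorem extGen_val (N : ℕ) (a : Fin N) :
    extGen N a = ExteriorAlgebra.ι ℂ (Pi.single a 1) := by
  simp [extGen]

theorem extGen_sq (N k : ℕ) : extGen N k * extGen N k = 0 := by
  unfold extGen
  split_ifs <;> simp

theorem extGen_mul_swap (N j k : ℕ) : extGen N j * extGen N k = -(extGen N k * extGen N j) := by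
  unfold extGen
  split_ifs
  · exact eq_neg_of_add_eq_zero_left (ExteriorAlgebra.ι_add_mul_swap _ _)
  all_goals simp

/-- The coefficient of the top form `e₀ ∧ ⋯ ∧ e_{N-1}`. -/
noncomputable def topCoeff (N : ℕ) : ExteriorAlgebra ℂ (Fin N → ℂ) →ₗ[ℂ] ℂ :=
  ExteriorAlgebra.liftAlternating (Pi.single N Matrix.detRowAlternating)

/-- The coefficient is the determinant of the matrix whose rows are the basis vectors numbered by
`p`; the right side is its Leibniz expansion. -/
theorem topCoeff_prod_ofFn (N : ℕ) (p : Fin N → Fin N) :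
    topCoeff N (List.ofFn fun i => extGen N (p i)).prod
      = ∑ σ : Equiv.Perm (Fin N), ((Equiv.Perm.sign σ : ℤ) : ℂ) * if p = σ then 1 else 0 := by
  simp_rw [extGen_val]
  rw [← ExteriorAlgebra.ιMulti_apply, topCoeff, ExteriorAlgebra.liftAlternating_apply_ιMulti,
    Pi.single_eq_same]
  change Matrix.det (Matrix.of fun i => Pi.single (p i) 1) = _
  rw [← Matrix.det_transpose, Matrix.det_apply']
  refine Finset.sum_congr rfl fun σ _ => ?_
  congr 1
  simp only [Matrix.transpose_apply, Matrix.of_apply, Pi.single_apply, Finset.prod_ite_zero,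
    Finset.prod_const_one, Finset.mem_univ, true_imp_iff, funext_iff]
  refine if_congr (forall_congr' fun i => eq_comm) rfl rfl

/-- The summands are products of two generators, so they commute and square to zero; the power is
`m!` times the ordered product of all generators. -/
theorem topCoeff_symplecticForm_pow (m : ℕ) :
    topCoeff (2 * m)
      ((∑ j ∈ Finset.range m, extGen (2 * m) (2 * j) * extGen (2 * m) (2 * j + 1)) ^ m)
      = m.factorial := by
  have hanti := extGen_mul_swap (2 * m)
  have hc : ∀ i j, Commute (extGen (2 * m) (2 * i) * extGen (2 * m) (2 * i + 1))
      (extGen (2 * m) (2 * j) * extGen (2 * m) (2 * j + 1)) := by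
    have h1 : ∀ i j k, Commute (extGen (2 * m) i * extGen (2 * m) j) (extGen (2 * m) k) := by
      intro i j k
      rw [commute_iff_eq, mul_assoc, hanti j k, mul_neg, ← mul_assoc, hanti i k, neg_mul, neg_neg,
        mul_assoc]
    exact fun i j => (h1 _ _ _).mul_right (h1 _ _ _)
  have hu : ∀ i, extGen (2 * m) (2 * i) * extGen (2 * m) (2 * i + 1)
      * (extGen (2 * m) (2 * i) * extGen (2 * m) (2 * i + 1)) = 0 := by
    intro i
    rw [mul_assoc, ← mul_assoc (extGen (2 * m) (2 * i + 1)), hanti (2 * i + 1), neg_mul, mul_assoc,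
      extGen_sq]
    simp
  rw [(sum_range_pow_of_sq_eq_zero (fun j => extGen (2 * m) (2 * j) * extGen (2 * m) (2 * j + 1))
    hc hu m).1, ← prod_map_range_two_mul, map_nsmul]
  have h2 : (List.range (2 * m)).map (extGen (2 * m))
      = List.ofFn fun i : Fin (2 * m) => extGen (2 * m) ((id i : Fin (2 * m)) : ℕ) := by
    rw [← List.map_coe_finRange_eq_range, List.map_map, List.ofFn_eq_map]
    rfl
  rw [h2, topCoeff_prod_ofFn, Finset.sum_eq_single 1]
  · simp
  · intro σ _ hσ
    rw [if_neg, mul_zero]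
    intro h
    exact hσ (Equiv.coe_fn_injective h.symm)
  · simp

/-- The commutators `[D_a, D_b]` of the operators `D_{2j} = ∂_j`, `D_{2j+1} = x_j`. -/
def heisenbergForm (a b : ℕ) : ℂ :=
  if a % 2 = 0 ∧ b = a + 1 then 1 else if b % 2 = 0 ∧ a = b + 1 then -1 else 0

theorem sum_heisenbergForm_extGen (m : ℕ) :
    ∑ a : Fin (2 * m), ∑ b : Fin (2 * m),
      heisenbergForm a b • (extGen (2 * m) a * extGen (2 * m) b)
      = (2 : ℂ) • ∑ j ∈ Finset.range m, extGen (2 * m) (2 * j) * extGen (2 * m) (2 * j + 1) := by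
  have h0 : ∀ a, ∑ b : Fin (2 * m), heisenbergForm a b • (extGen (2 * m) a * extGen (2 * m) b)
      = ∑ b ∈ Finset.range (2 * m), heisenbergForm a b • (extGen (2 * m) a * extGen (2 * m) b) :=
    fun a => Fin.sum_univ_eq_sum_range
      (fun b => heisenbergForm a b • (extGen (2 * m) a * extGen (2 * m) b)) _
  simp_rw [h0]
  rw [Fin.sum_univ_eq_sum_range (fun a => ∑ b ∈ Finset.range (2 * m),
    heisenbergForm a b • (extGen (2 * m) a * extGen (2 * m) b)) (2 * m), sum_range_two_mul,
    Finset.smul_sum]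
  refine Finset.sum_congr rfl fun j hj => ?_
  rw [Finset.mem_range] at hj
  rw [Finset.sum_eq_single (2 * j + 1), Finset.sum_eq_single (2 * j)]
  · have h1 : heisenbergForm (2 * j) (2 * j + 1) = 1 := by simp [heisenbergForm]
    have h2 : heisenbergForm (2 * j + 1) (2 * j) = -1 := by
      simp [heisenbergForm]
    rw [h1, h2, extGen_mul_swap _ (2 * j + 1), two_smul]
    simp
  · intro b _ hb
    rw [heisenbergForm, if_neg (by omega), if_neg (by omega), zero_smul]
  · intro h
    exact absurd (Finset.mem_range.2 (by omega)) h
  · intro b _ hb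
    rw [heisenbergForm, if_neg (by omega), if_neg (by omega), zero_smul]
  · intro h
    exact absurd (Finset.mem_range.2 (by omega)) h

/-- To be read with `d a = [D_a, T]`, `A a = T D_a T`, `B a b = T D_a D_b T`, `γ = ĝ` and `τ` the
trace on the range of `T`. Unbounded operators enter only through these bounded combinations. -/
theorem sum_sign_trace_prod {E : Type*} [Ring E] [Algebra ℂ E] {m : ℕ} (T γ : E)
    (d A : Fin (2 * m) → E) (B : Fin (2 * m) → Fin (2 * m) → E) (τ : E →ₗ[ℂ] ℂ)
    (hTA : ∀ a, T * A a = A a) (hAT : ∀ a, A a * T = A a)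
    (hγA : ∀ a, γ * A a = A a * γ)
    (hd : ∀ a b, d a * d b * T = A a * A b - B a b)
    (hB : ∀ a b, B a b - B b a = heisenbergForm a b • T)
    (hτT : ∀ X, τ (X * T) = τ X) (hτA : ∀ a X, τ (A a * X) = τ (X * A a)) :
    ∑ σ : Equiv.Perm (Fin (2 * m)), ((Equiv.Perm.sign σ : ℤ) : ℂ) *
      τ (γ * T * (List.ofFn fun i => d (σ i)).prod) = (-1) ^ m * m.factorial * τ (γ * T) := by
  set e := extGen (2 * m) with he
  set Ω := ∑ j ∈ Finset.range m, e (2 * j) * e (2 * j + 1) with hΩ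
  let L : ExteriorAlgebra ℂ (Fin (2 * m) → ℂ) ⊗[ℂ] E →ₗ[ℂ] ℂ :=
    LinearMap.mul' ℂ ℂ ∘ₗ TensorProduct.map (topCoeff (2 * m)) (τ ∘ₗ LinearMap.mulLeft ℂ γ)
  have hL : ∀ x X, L (x ⊗ₜ X) = topCoeff (2 * m) x * τ (γ * X) := fun x X => by simp [L]
  let dd : ExteriorAlgebra ℂ (Fin (2 * m) → ℂ) ⊗[ℂ] E := ∑ a : Fin (2 * m), e a ⊗ₜ d a
  let AA : ExteriorAlgebra ℂ (Fin (2 * m) → ℂ) ⊗[ℂ] E := ∑ a : Fin (2 * m), e a ⊗ₜ A a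
  let TT : ExteriorAlgebra ℂ (Fin (2 * m) → ℂ) ⊗[ℂ] E := 1 ⊗ₜ T
  let ΩΩ : ExteriorAlgebra ℂ (Fin (2 * m) → ℂ) ⊗[ℂ] E := Ω ⊗ₜ 1
  have hanti : ∀ j k, e j * e k = -(e k * e j) := extGen_mul_swap (2 * m)
  have hee : ∀ i j k, Commute (e i * e j) (e k) := by
    intro i j k
    rw [commute_iff_eq, mul_assoc, hanti j k, mul_neg, ← mul_assoc, hanti i k, neg_mul, neg_neg,
      mul_assoc]
  have hΩe : ∀ k, Commute Ω (e k) := fun k => Commute.sum_left _ _ _ fun i _ => hee _ _ _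
  have hLT : ∀ Y, L (Y * TT) = L Y := by
    intro Y
    induction Y with
    | zero => simp
    | add x y hx hy => rw [add_mul, map_add, hx, hy, map_add]
    | tmul x X =>
      rw [Algebra.TensorProduct.tmul_mul_tmul, mul_one, hL, hL, ← mul_assoc, hτT]
  have hLHS : L (TT * dd ^ (2 * m)) = ∑ σ : Equiv.Perm (Fin (2 * m)),
      ((Equiv.Perm.sign σ : ℤ) : ℂ) * τ (γ * T * (List.ofFn fun i => d (σ i)).prod) := by
    rw [sum_pow_eq_sum_prod_ofFn, Finset.mul_sum, map_sum]
    simp_rw [tmul_prod_ofFn, TT, Algebra.TensorProduct.tmul_mul_tmul, one_mul, hL, he,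
      topCoeff_prod_ofFn, Finset.sum_mul]
    rw [Finset.sum_comm]
    refine Finset.sum_congr rfl fun σ _ => ?_
    rw [Finset.sum_eq_single (σ : Fin (2 * m) → Fin (2 * m))]
    · simp [mul_assoc]
    · intro p _ hp
      simp [hp]
    · simp
  have hAA : AA * AA = ∑ a : Fin (2 * m), ∑ b : Fin (2 * m), (e a * e b) ⊗ₜ (A a * A b) := by
    simp [AA, Finset.sum_mul_sum, Algebra.TensorProduct.tmul_mul_tmul]
  -- Only the antisymmetric part of `B` is seen. Each conjugate pair occurs in both orders, which
  -- gives the factor 2 cancelled below.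
  have hBB : ∑ a : Fin (2 * m), ∑ b : Fin (2 * m), (e a * e b) ⊗ₜ[ℂ] B a b = ΩΩ * TT := by
    have h1 : ∑ a : Fin (2 * m), ∑ b : Fin (2 * m), (e a * e b) ⊗ₜ[ℂ] B b a
        = -∑ a : Fin (2 * m), ∑ b : Fin (2 * m), (e a * e b) ⊗ₜ[ℂ] B a b := by
      rw [Finset.sum_comm, ← Finset.sum_neg_distrib]
      refine Finset.sum_congr rfl fun a _ => ?_
      rw [← Finset.sum_neg_distrib]
      refine Finset.sum_congr rfl fun b _ => ?_
      rw [hanti, TensorProduct.neg_tmul]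
    have h2 : (2 : ℂ) • ∑ a : Fin (2 * m), ∑ b : Fin (2 * m), (e a * e b) ⊗ₜ[ℂ] B a b
        = (2 : ℂ) • (ΩΩ * TT) := by
      have h3 : (2 : ℂ) • ∑ a : Fin (2 * m), ∑ b : Fin (2 * m), (e a * e b) ⊗ₜ[ℂ] B a b
          = ∑ a : Fin (2 * m), ∑ b : Fin (2 * m), (e a * e b) ⊗ₜ[ℂ] (B a b - B b a) := by
        simp_rw [TensorProduct.tmul_sub, Finset.sum_sub_distrib]
        rw [h1, two_smul, sub_neg_eq_add]
      rw [h3]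
      simp_rw [hB, TensorProduct.tmul_smul, TensorProduct.smul_tmul', ← TensorProduct.sum_tmul]
      rw [he, sum_heisenbergForm_extGen, ← he, ← hΩ, ← TensorProduct.smul_tmul']
      simp [ΩΩ, TT]
    exact smul_right_injective _ two_ne_zero h2
  have hddT : dd * dd * TT = (AA * AA - ΩΩ) * TT := by
    have h1 : dd * dd * TT
        = ∑ a : Fin (2 * m), ∑ b : Fin (2 * m), (e a * e b) ⊗ₜ (d a * d b * T) := by
      simp only [dd, TT, Finset.sum_mul, Finset.mul_sum, Algebra.TensorProduct.tmul_mul_tmul,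
        mul_one]
      exact Finset.sum_comm
    have h2 : AA * TT = AA := by
      simp [AA, TT, Finset.sum_mul, Algebra.TensorProduct.tmul_mul_tmul, hAT]
    rw [h1, sub_mul, mul_assoc AA, h2, hAA, ← hBB]
    simp_rw [hd, TensorProduct.tmul_sub, Finset.sum_sub_distrib]
  have hTAA : Commute TT AA := by
    simp [commute_iff_eq, AA, TT, Finset.sum_mul, Finset.mul_sum,
      Algebra.TensorProduct.tmul_mul_tmul, hAT, hTA]
  have hTΩ : Commute TT ΩΩ := by
    simp [commute_iff_eq, ΩΩ, TT, Algebra.TensorProduct.tmul_mul_tmul]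
  have hΩA : Commute ΩΩ AA := by
    refine Commute.sum_right _ _ _ fun a _ => ?_
    rw [commute_iff_eq, Algebra.TensorProduct.tmul_mul_tmul, Algebra.TensorProduct.tmul_mul_tmul,
      one_mul, mul_one, (hΩe a).eq]
  set Z := AA * AA - ΩΩ with hZ
  have hTZ : Commute TT Z := (hTAA.mul_right hTAA).sub_right hTΩ
  have hΩZ : Commute ΩΩ Z := (hΩA.mul_right hΩA).sub_right (Commute.refl _)
  have hAZ : Commute AA Z := ((Commute.refl AA).mul_right (Commute.refl _)).sub_right hΩA.symm
  have hpow : ∀ k, (dd * dd) ^ k * TT = Z ^ k * TT := by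
    intro k
    induction k with
    | zero => simp
    | succ k ih =>
      rw [pow_succ, mul_assoc, hddT, ← hTZ.eq, ← mul_assoc, ih, mul_assoc, hTZ.eq, ← mul_assoc,
        ← pow_succ]
  have hodd : ∀ x X, (∀ k, e k * x = -(x * e k)) → L (AA * x ⊗ₜ X) = -L (x ⊗ₜ X * AA) := by
    intro x X hx
    simp_rw [AA, Finset.sum_mul, Finset.mul_sum, map_sum, ← Finset.sum_neg_distrib,
      Algebra.TensorProduct.tmul_mul_tmul, hL]
    refine Finset.sum_congr rfl fun a _ => ?_
    rw [hx, map_neg, neg_mul, ← mul_assoc, hγA, mul_assoc, hτA, mul_assoc]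
  -- `O` plays the role of the odd part: coefficients anticommuting with every generator. On it `L`
  -- is a supertrace with respect to `AA`.
  let O : Submodule ℂ (ExteriorAlgebra ℂ (Fin (2 * m) → ℂ) ⊗[ℂ] E) :=
    Submodule.span ℂ {Y | ∃ x X, (∀ k, e k * x = -(x * e k)) ∧ Y = x ⊗ₜ X}
  have hO : ∀ Y ∈ O, L (AA * Y) = -L (Y * AA) := by
    intro Y hY
    induction hY using Submodule.span_induction with
    | mem Y h =>
      obtain ⟨x, X, hx, rfl⟩ := h
      exact hodd x X hx
    | zero => simp
    | add y z _ _ hy hz => rw [mul_add, add_mul, map_add, map_add, hy, hz, neg_add]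
    | smul c y _ hy => rw [mul_smul_comm, smul_mul_assoc, map_smul, map_smul, hy, smul_neg]
  have hmem : ∀ w W, (∀ k, Commute w (e k)) → ∀ Y ∈ O, w ⊗ₜ W * Y ∈ O := by
    intro w W hw Y hY
    induction hY using Submodule.span_induction with
    | mem Y h =>
      obtain ⟨x, X, hx, rfl⟩ := h
      refine Submodule.subset_span ⟨w * x, W * X, fun k => ?_, ?_⟩
      · rw [← mul_assoc, ← (hw k).eq, mul_assoc, hx, mul_neg, mul_assoc]
      · rw [Algebra.TensorProduct.tmul_mul_tmul]
    | zero => simp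
    | add y z _ _ hy hz => rw [mul_add]; exact O.add_mem hy hz
    | smul c y _ hy => rw [mul_smul_comm]; exact O.smul_mem c hy
  have hΩO : ∀ Y ∈ O, ΩΩ * Y ∈ O := hmem Ω 1 hΩe
  have hZO : ∀ Y ∈ O, Z * Y ∈ O := by
    intro Y hY
    rw [hZ, sub_mul, hAA, Finset.sum_mul]
    refine O.sub_mem (O.sum_mem fun a _ => ?_) (hΩO Y hY)
    rw [Finset.sum_mul]
    exact O.sum_mem fun b _ => hmem _ _ (fun k => hee _ _ _) Y hY
  have hAO : AA ∈ O := O.sum_mem fun a _ =>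
    Submodule.subset_span ⟨e a, A a, fun k => hanti _ _, rfl⟩
  have hpowO : ∀ W : ExteriorAlgebra ℂ (Fin (2 * m) → ℂ) ⊗[ℂ] E, (∀ Y ∈ O, W * Y ∈ O) →
      ∀ k, ∀ Y ∈ O, W ^ k * Y ∈ O := by
    intro W hW k
    induction k with
    | zero => simp
    | succ k ih =>
      intro Y hY
      rw [pow_succ, mul_assoc]
      exact ih _ (hW Y hY)
  -- Commuting gives `L (AA * Y) = L (Y * AA)`, oddness gives the opposite sign.
  have hvanish : ∀ Y ∈ O, Commute AA Y → L (AA * Y) = 0 := by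
    intro Y hY hc
    have h := hO Y hY
    rw [← hc.eq] at h
    exact self_eq_neg.1 h
  have hLZ : L (Z ^ m) = L ((-ΩΩ) ^ m) := by
    -- The difference of the `m`-th powers of `Z` and `-ΩΩ` has the factor `Z + ΩΩ = AA * AA`; one
    -- copy of `AA` is split off, the other makes the rest odd.
    have h1 := hΩZ.symm.neg_right.mul_geom_sum₂ m
    rw [sub_neg_eq_add, show Z + ΩΩ = AA * AA by rw [hZ, sub_add_cancel], Finset.mul_sum] at h1
    rw [← sub_eq_zero, ← map_sub, ← h1, map_sum]
    refine Finset.sum_eq_zero fun i _ => ?_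
    rw [mul_assoc]
    have h2 : Commute AA (Z ^ i * (-ΩΩ) ^ (m - 1 - i)) :=
      (hAZ.pow_right _).mul_right (hΩA.symm.neg_right.pow_right _)
    refine hvanish _ ?_ ((Commute.refl AA).mul_right h2)
    rw [h2.eq, mul_assoc]
    refine hpowO Z hZO _ _ (hpowO _ (fun Y hY => ?_) _ _ hAO)
    rw [neg_mul]
    exact O.neg_mem (hΩO Y hY)
  have hΩpow : (-ΩΩ) ^ m = (-1 : ℂ) ^ m • ((Ω ^ m) ⊗ₜ (1 : E)) := by
    rcases Nat.even_or_odd m with h | h <;>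
      simp [ΩΩ, h.neg_pow, Algebra.TensorProduct.tmul_pow]
  rw [← hLHS, pow_mul, pow_two, ← hLT, mul_assoc, hpow, ← mul_assoc, hLT, (hTZ.pow_right m).eq, hLT,
    hLZ, hΩpow, map_smul, hL, hΩ, he, topCoeff_symplecticForm_pow, mul_one, hτT, smul_eq_mul, mul_assoc]

end Algebra

/-! ### An integrable and square-integrable weight on Euclidean space -/

section Weight

variable {n : ℕ}

/-- The weight `(1 + ‖x‖)^{-(n+1)}`. -/
noncomputable def weight (x : Euc n) : ℝ := ((1 + ‖x‖) ^ (n + 1))⁻¹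

theorem weight_nonneg (x : Euc n) : 0 ≤ weight x := by unfold weight; positivity

theorem weight_le_one (x : Euc n) : weight x ≤ 1 :=
  inv_le_one_of_one_le₀ (one_le_pow₀ (by simp))

theorem continuous_weight : Continuous (weight (n := n)) := by
  unfold weight
  exact Continuous.inv₀ (by fun_prop) fun x => by positivity

theorem integrable_weight : Integrable (weight (n := n)) := by
  have h := integrable_one_add_norm (E := Euc n) (μ := volume) (r := (n + 1 : ℕ)) (by simp)
  refine h.congr (Filter.Eventually.of_forall fun x => ?_)
  dsimp only
  rw [weight, Real.rpow_neg (by positivity), Real.rpow_natCast]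

theorem integrable_weight_sq : Integrable fun x : Euc n => weight x ^ 2 := by
  refine integrable_weight.mono' (continuous_weight.pow 2).aestronglyMeasurable
    (Filter.Eventually.of_forall fun x => ?_)
  rw [Real.norm_of_nonneg (sq_nonneg _), pow_two]
  exact mul_le_of_le_one_left (weight_nonneg x) (weight_le_one x)

theorem memLp_weight : MemLp (weight (n := n)) 2 volume :=
  (memLp_two_iff_integrable_sq continuous_weight.aestronglyMeasurable).2 integrable_weight_sq

variable {Y : Type*} [NormedAddCommGroup Y]

theorem integrable_weight_mul_norm (f : L2 n Y) : Integrable fun y => weight y * ‖f y‖ :=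
  memLp_weight.integrable_mul (Lp.memLp f).norm

theorem integral_weight_mul_norm_le (f : L2 n Y) :
    ∫ y, weight y * ‖f y‖ ≤ ‖(memLp_weight (n := n)).toLp‖ * ‖f‖ := by
  have h := real_inner_le_norm (memLp_weight (n := n)).toLp (Lp.memLp f).norm.toLp
  have h2 : ‖(Lp.memLp f).norm.toLp‖ = ‖f‖ := by
    rw [Lp.norm_toLp, eLpNorm_norm, Lp.norm_def]
  rw [h2, L2.inner_def] at h
  refine le_trans (le_of_eq (integral_congr_ae ?_)) h
  filter_upwards [(memLp_weight (n := n)).coeFn_toLp, (Lp.memLp f).norm.coeFn_toLp] with y h3 h4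
  rw [h3, h4]
  simp [mul_comm]

end Weight

/-! ### Schwartz kernels map `L²` into Schwartz functions -/

section Kernel

variable {n : ℕ} {X Y Z : Type*} [NormedAddCommGroup X] [NormedSpace ℝ X]
  [NormedAddCommGroup Y] [NormedSpace ℝ Y] [NormedAddCommGroup Z] [NormedSpace ℝ Z]

theorem exists_norm_kernel_le (K : 𝓢(Euc n × Euc n, X)) (k : ℕ) :
    ∃ C, 0 ≤ C ∧ ∀ x y, ‖x‖ ^ k * ‖K (x, y)‖ ≤ C * weight x * weight y := by
  -- The order of decay pays for `‖x‖ ^ k` and for one weight in each variable.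
  refine ⟨2 ^ (k + (n + 1) + (n + 1)) * (Finset.Iic (k + (n + 1) + (n + 1), 0)).sup
    (fun m => SchwartzMap.seminorm ℝ m.1 m.2) K, mul_nonneg (by positivity) (apply_nonneg _ _),
    fun x y => ?_⟩
  · have h := SchwartzMap.one_add_le_sup_seminorm_apply (𝕜 := ℝ)
      (m := (k + (n + 1) + (n + 1), 0)) le_rfl le_rfl K (x, y)
    rw [norm_iteratedFDeriv_zero] at h
    have hx : ‖x‖ ≤ ‖(x, y)‖ := norm_fst_le (x, y)
    have hy : ‖y‖ ≤ ‖(x, y)‖ := norm_snd_le (x, y)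
    rw [weight, weight, ← div_eq_mul_inv, ← div_eq_mul_inv, div_div, le_div_iff₀ (by positivity)]
    refine le_trans ?_ h
    calc ‖x‖ ^ k * ‖K (x, y)‖ * ((1 + ‖x‖) ^ (n + 1) * (1 + ‖y‖) ^ (n + 1))
        = ‖x‖ ^ k * (1 + ‖x‖) ^ (n + 1) * (1 + ‖y‖) ^ (n + 1) * ‖K (x, y)‖ := by ring
      _ ≤ (1 + ‖(x, y)‖) ^ k * (1 + ‖(x, y)‖) ^ (n + 1) * (1 + ‖(x, y)‖) ^ (n + 1)
          * ‖K (x, y)‖ := by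
        gcongr
        linarith
      _ = (1 + ‖(x, y)‖) ^ (k + (n + 1) + (n + 1)) * ‖K (x, y)‖ := by ring

theorem aestronglyMeasurable_kernel_apply (K : 𝓢(Euc n × Euc n, Y →L[ℝ] Z)) (f : L2 n Y)
    (x : Euc n) : AEStronglyMeasurable (fun y => K (x, y) (f y)) volume :=
  (ContinuousLinearMap.id ℝ (Y →L[ℝ] Z)).aestronglyMeasurable_comp₂
    (K.continuous.comp (Continuous.prodMk_right x)).aestronglyMeasurable
    (Lp.aestronglyMeasurable f)

theorem exists_norm_kernel_apply_le (K : 𝓢(Euc n × Euc n, Y →L[ℝ] Z)) (k : ℕ) :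
    ∃ C, 0 ≤ C ∧ ∀ (f : L2 n Y) x y,
      ‖x‖ ^ k * ‖K (x, y) (f y)‖ ≤ C * weight x * (weight y * ‖f y‖) := by
  obtain ⟨C, hC, h⟩ := exists_norm_kernel_le K k
  refine ⟨C, hC, fun f x y => ?_⟩
  calc ‖x‖ ^ k * ‖K (x, y) (f y)‖ ≤ ‖x‖ ^ k * (‖K (x, y)‖ * ‖f y‖) := by
        gcongr
        exact (K (x, y)).le_opNorm _
    _ = ‖x‖ ^ k * ‖K (x, y)‖ * ‖f y‖ := by ring
    _ ≤ C * weight x * weight y * ‖f y‖ :=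
        mul_le_mul_of_nonneg_right (h x y) (norm_nonneg _)
    _ = _ := by ring

theorem integrable_kernel_apply (K : 𝓢(Euc n × Euc n, Y →L[ℝ] Z)) (f : L2 n Y) (x : Euc n) :
    Integrable fun y => K (x, y) (f y) := by
  obtain ⟨C, -, h⟩ := exists_norm_kernel_apply_le K 0
  refine ((integrable_weight_mul_norm f).const_mul (C * weight x)).mono'
    (aestronglyMeasurable_kernel_apply K f x) (Filter.Eventually.of_forall fun y => ?_)
  simpa using h f x y

theorem exists_norm_integral_kernel_le (K : 𝓢(Euc n × Euc n, Y →L[ℝ] Z)) (k : ℕ) :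
    ∃ C, 0 ≤ C ∧ ∀ (f : L2 n Y) x,
      ‖x‖ ^ k * ‖∫ y, K (x, y) (f y)‖ ≤ C * weight x * ‖f‖ := by
  obtain ⟨C, hC, h⟩ := exists_norm_kernel_apply_le K k
  refine ⟨C * ‖(memLp_weight (n := n)).toLp‖, by positivity, fun f x => ?_⟩
  have h0 := weight_nonneg x
  calc ‖x‖ ^ k * ‖∫ y, K (x, y) (f y)‖ ≤ ‖x‖ ^ k * ∫ y, ‖K (x, y) (f y)‖ := by
        gcongr
        exact norm_integral_le_integral_norm _
    _ = ∫ y, ‖x‖ ^ k * ‖K (x, y) (f y)‖ := (integral_const_mul _ _).symm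
    _ ≤ ∫ y, C * weight x * (weight y * ‖f y‖) := by
        refine integral_mono ((integrable_kernel_apply K f x).norm.const_mul _)
          ((integrable_weight_mul_norm f).const_mul _) fun y => h f x y
    _ = C * weight x * ∫ y, weight y * ‖f y‖ := integral_const_mul _ _
    _ ≤ C * weight x * (‖(memLp_weight (n := n)).toLp‖ * ‖f‖) := by
        gcongr
        exact integral_weight_mul_norm_le f
    _ = _ := by ring

/-- The derivative of a kernel in its first variable. -/
noncomputable def kernelDerivFst (K : 𝓢(Euc n × Euc n, Y →L[ℝ] Z)) :
    𝓢(Euc n × Euc n, Y →L[ℝ] (Euc n →L[ℝ] Z)) :=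
  SchwartzMap.postcompCLM (𝕜 := ℝ)
    (((ContinuousLinearMap.flipₗᵢ ℝ (Euc n) Y Z).toContinuousLinearEquiv :
      (Euc n →L[ℝ] Y →L[ℝ] Z) →L[ℝ] (Y →L[ℝ] Euc n →L[ℝ] Z)).comp
      (ContinuousLinearMap.precomp (Y →L[ℝ] Z) (ContinuousLinearMap.inl ℝ (Euc n) (Euc n))))
    (SchwartzMap.fderivCLM ℝ (Euc n × Euc n) (Y →L[ℝ] Z) K)

theorem kernelDerivFst_apply (K : 𝓢(Euc n × Euc n, Y →L[ℝ] Z)) (p : Euc n × Euc n) (y : Y)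
    (v : Euc n) : kernelDerivFst K p y v = fderiv ℝ K p (v, 0) y := by
  simp [kernelDerivFst]

theorem hasFDerivAt_integral_kernel (K : 𝓢(Euc n × Euc n, Y →L[ℝ] Z)) (f : L2 n Y) (x : Euc n) :
    HasFDerivAt (fun x => ∫ y, K (x, y) (f y)) (∫ y, kernelDerivFst K (x, y) (f y)) x := by
  obtain ⟨C, hC, h⟩ := exists_norm_kernel_apply_le (kernelDerivFst K) 0
  refine hasFDerivAt_integral_of_dominated_of_fderiv_le (s := Set.univ)
    (F := fun x y => K (x, y) (f y)) (F' := fun x y => kernelDerivFst K (x, y) (f y))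
    (bound := fun y => C * (weight y * ‖f y‖)) Filter.univ_mem
    (Filter.Eventually.of_forall fun x => aestronglyMeasurable_kernel_apply K f x)
    (integrable_kernel_apply K f x) (aestronglyMeasurable_kernel_apply _ f x)
    (Filter.Eventually.of_forall fun y x _ => ?_) ((integrable_weight_mul_norm f).const_mul C)
    (Filter.Eventually.of_forall fun y x _ => ?_)
  · have h1 := h f x y
    rw [pow_zero, one_mul] at h1
    refine h1.trans ?_
    have h2 := weight_nonneg y
    gcongr
    exact mul_le_of_le_one_right hC (weight_le_one x)
  · have h1 : HasFDerivAt (fun x => K (x, y))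
        ((fderiv ℝ K (x, y)).comp (ContinuousLinearMap.inl ℝ (Euc n) (Euc n))) x :=
      (K.hasFDerivAt (x, y)).comp x (hasFDerivAt_prodMk_left x y)
    have h2 := (ContinuousLinearMap.apply ℝ Z (f y)).hasFDerivAt.comp x h1
    refine h2.congr_fderiv ?_
    ext v
    simp [kernelDerivFst_apply]

/-- The target `Z` is quantified inside the induction because differentiating replaces it by `Euc n
→L[ℝ] Z`. -/
theorem contDiff_integral_kernel_aux (f : L2 n Y) (k N : ℕ) : ∀ {Z : Type _}
    [NormedAddCommGroup Z] [NormedSpace ℝ Z] (K : 𝓢(Euc n × Euc n, Y →L[ℝ] Z)),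
    ContDiff ℝ N (fun x => ∫ y, K (x, y) (f y)) ∧
      ∃ C, ∀ x, ‖x‖ ^ k * ‖iteratedFDeriv ℝ N (fun x => ∫ y, K (x, y) (f y)) x‖ ≤ C := by
  induction N with
  | zero =>
    intro Z _ _ K
    refine ⟨contDiff_zero.2 (continuous_iff_continuousAt.2 fun x =>
      (hasFDerivAt_integral_kernel K f x).continuousAt), ?_⟩
    obtain ⟨C, hC, h⟩ := exists_norm_integral_kernel_le K k
    refine ⟨C * ‖f‖, fun x => ?_⟩
    rw [norm_iteratedFDeriv_zero]
    refine (h f x).trans ?_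
    gcongr
    exact mul_le_of_le_one_right hC (weight_le_one x)
  | succ N ih =>
    intro Z _ _ K
    have hfd : fderiv ℝ (fun x => ∫ y, K (x, y) (f y))
        = fun x => ∫ y, kernelDerivFst K (x, y) (f y) :=
      funext fun x => (hasFDerivAt_integral_kernel K f x).fderiv
    obtain ⟨h1, C, hC⟩ := ih (kernelDerivFst K)
    refine ⟨?_, C, fun x => ?_⟩
    · rw [Nat.cast_add, Nat.cast_one, contDiff_succ_iff_fderiv]
      refine ⟨fun x => (hasFDerivAt_integral_kernel K f x).differentiableAt, by simp, ?_⟩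
      rw [hfd]
      exact h1
    · rw [← norm_iteratedFDeriv_fderiv, hfd]
      exact hC x

theorem exists_schwartz_eq_integral_kernel (K : 𝓢(Euc n × Euc n, Y →L[ℝ] Z)) (f : L2 n Y) :
    ∃ ψ : 𝓢(Euc n, Z), ∀ x, ψ x = ∫ y, K (x, y) (f y) :=
  ⟨⟨fun x => ∫ y, K (x, y) (f y),
    contDiff_infty.2 fun N => (contDiff_integral_kernel_aux f 0 N K).1,
    fun k N => (contDiff_integral_kernel_aux f k N K).2⟩, fun _ => rfl⟩

end Kernel

/-! ### Idempotent Schwartz-kernel operators have finite rank -/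

theorem integrable_norm_sq {n : ℕ} {F : Type*} [NormedAddCommGroup F] (f : L2 n F) :
    Integrable fun x => ‖f x‖ ^ 2 :=
  (memLp_two_iff_integrable_sq_norm (Lp.aestronglyMeasurable f)).1 (Lp.memLp f)

section KernelOperator

variable {n : ℕ} {F : Type*} [NormedAddCommGroup F] [InnerProductSpace ℂ F]

/-- The kernel `K` regarded as a kernel with values in the real-linear maps. -/
noncomputable def realKernel (K : 𝓢(Euc n × Euc n, F →L[ℂ] F)) :
    𝓢(Euc n × Euc n, F →L[ℝ] F) :=
  SchwartzMap.postcompCLM (𝕜 := ℝ) (ContinuousLinearMap.restrictScalarsL ℂ F F ℝ ℝ) K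

theorem realKernel_apply (K : 𝓢(Euc n × Euc n, F →L[ℂ] F)) (p : Euc n × Euc n) (y : F) :
    realKernel K p y = K p y := rfl

/-- The functional `f ↦ ∫ K(x, y) f(y) dy`, for a fixed `x`. -/
theorem exists_kernelEval (K : 𝓢(Euc n × Euc n, F →L[ℂ] F)) :
    ∃ (C : ℝ) (G : Euc n → L2 n F →L[ℂ] F), 0 ≤ C ∧ (∀ x f, G x f = ∫ y, K (x, y) (f y)) ∧
      ∀ x, ‖G x‖ ≤ C * weight x := by
  obtain ⟨C, hC, h⟩ := exists_norm_integral_kernel_le (realKernel K) 0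
  have hint := integrable_kernel_apply (realKernel K)
  simp only [pow_zero, one_mul, realKernel_apply] at h hint
  have hadd : ∀ x (f g : L2 n F), ∫ y, K (x, y) ((f + g : L2 n F) y)
      = (∫ y, K (x, y) (f y)) + ∫ y, K (x, y) (g y) := by
    intro x f g
    rw [← integral_add (hint f x) (hint g x)]
    refine integral_congr_ae ?_
    filter_upwards [Lp.coeFn_add f g] with y hy
    rw [hy, Pi.add_apply, map_add]
  have hsmul : ∀ x (c : ℂ) (f : L2 n F), ∫ y, K (x, y) ((c • f : L2 n F) y)
      = c • ∫ y, K (x, y) (f y) := by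
    intro x c f
    rw [← integral_smul]
    refine integral_congr_ae ?_
    filter_upwards [Lp.coeFn_smul c f] with y hy
    rw [hy, Pi.smul_apply, map_smul]
  let G : Euc n → L2 n F →ₗ[ℂ] F := fun x =>
    { toFun := fun f => ∫ y, K (x, y) (f y), map_add' := hadd x, map_smul' := hsmul x }
  exact ⟨C, fun x => (G x).mkContinuous (C * weight x) fun f => h f x, hC, fun _ _ => rfl,
    fun x => LinearMap.mkContinuous_norm_le _ (mul_nonneg hC (weight_nonneg x)) _⟩

/-- Bessel's inequality for the Riesz vector of each coordinate of `G`; there are `finrank ℂ F`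
coordinates. -/
theorem sum_norm_sq_le_of_orthonormal {H : Type*} [NormedAddCommGroup H] [InnerProductSpace ℂ H]
    [CompleteSpace H] [FiniteDimensional ℂ F] {ι : Type*} [Fintype ι] (e : ι → H)
    (he : Orthonormal ℂ e) (G : H →L[ℂ] F) :
    ∑ i, ‖G (e i)‖ ^ 2 ≤ Module.finrank ℂ F * ‖G‖ ^ 2 := by
  let b := stdOrthonormalBasis ℂ F
  simp_rw [← b.sum_sq_norm_inner_right]
  rw [Finset.sum_comm]
  have h : ∀ j, ∑ i, ‖⟪b j, G (e i)⟫_ℂ‖ ^ 2 ≤ ‖G‖ ^ 2 := by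
    intro j
    let l : H →L[ℂ] ℂ := (innerSL ℂ (b j)).comp G
    have h1 : ‖l‖ ≤ ‖G‖ := by
      refine (ContinuousLinearMap.opNorm_comp_le _ _).trans ?_
      rw [innerSL_apply_norm, b.norm_eq_one, one_mul]
    have h2 := he.sum_inner_products_le (x := (InnerProductSpace.toDual ℂ H).symm l)
      (s := Finset.univ)
    rw [LinearIsometryEquiv.norm_map] at h2
    refine le_trans (le_of_eq ?_) (h2.trans (pow_le_pow_left₀ (norm_nonneg _) h1 2))
    refine Finset.sum_congr rfl fun i _ => ?_
    rw [norm_inner_symm (e i), InnerProductSpace.toDual_symm_apply]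
    rfl
  refine (Finset.sum_le_sum fun j _ => h j).trans ?_
  simp

theorem norm_sq_eq_integral (f : L2 n F) : ‖f‖ ^ 2 = ∫ x, ‖f x‖ ^ 2 := by
  have h : ((‖f‖ ^ 2 : ℝ) : ℂ) = ((∫ x, ‖f x‖ ^ 2 : ℝ) : ℂ) := by
    have h1 := inner_self_eq_norm_sq_to_K (𝕜 := ℂ) f
    rw [L2.inner_def] at h1
    simp only [inner_self_eq_norm_sq_to_K] at h1
    rw [← integral_complex_ofReal]
    push_cast
    exact h1.symm
  exact_mod_cast h

/-- The Schwartz representative of `T f` is unique, hence linear in `f`; this lets differential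
operators be applied after `T`. -/
theorem exists_schwartzLift {T : L2 n F →L[ℂ] L2 n F} (hT : IsSchwartzKernelOperator T) :
    ∃ σ : L2 n F →ₗ[ℂ] 𝓢(Euc n, F), ∀ f, (σ f).toLp 2 volume = T f := by
  obtain ⟨K, hK⟩ := hT
  let ι : 𝓢(Euc n, F) →ₗ[ℂ] L2 n F := (SchwartzMap.toLpCLM ℂ F 2 volume).toLinearMap
  have hι : Function.Injective ι := SchwartzMap.injective_toLp 2 volume
  have hmem : ∀ f, T f ∈ LinearMap.range ι := by
    intro f
    obtain ⟨ψ, hψ⟩ := exists_schwartz_eq_integral_kernel (realKernel K) f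
    refine ⟨ψ, Lp.ext ?_⟩
    filter_upwards [hK f, ψ.coeFn_toLp 2 volume] with x h1 h2
    rw [h1]
    exact h2.trans (hψ x)
  refine ⟨(LinearEquiv.ofInjective ι hι).symm.toLinearMap ∘ₗ
    (T : L2 n F →ₗ[ℂ] L2 n F).codRestrict _ hmem, fun f => ?_⟩
  have h := (LinearEquiv.ofInjective ι hι).apply_symm_apply
    ((T : L2 n F →ₗ[ℂ] L2 n F).codRestrict _ hmem f)
  exact congrArg Subtype.val h

variable [FiniteDimensional ℂ F] [CompleteSpace F]

/-- A Hilbert–Schmidt count: fixed vectors satisfy `e i x = G x (e i)` almost everywhere, so `∑ ‖e i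
x‖²` is at most a constant times `weight x ^ 2`; its integral is `k`. -/
theorem exists_card_bound_of_orthonormal {T : L2 n F →L[ℂ] L2 n F}
    (hT : IsSchwartzKernelOperator T) :
    ∃ N : ℕ, ∀ (k : ℕ) (e : Fin k → L2 n F), Orthonormal ℂ e → (∀ i, T (e i) = e i) → k ≤ N := by
  obtain ⟨K, hK⟩ := hT
  obtain ⟨C, G, hC, hG, hGC⟩ := exists_kernelEval K
  obtain ⟨N, hN⟩ := exists_nat_ge
    (∫ x : Euc n, Module.finrank ℂ F * C ^ 2 * weight x ^ 2)
  refine ⟨N, fun k e he hTe => ?_⟩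
  have h1 : ∀ i, ‖e i‖ ^ 2 = ∫ x, ‖e i x‖ ^ 2 := fun i => norm_sq_eq_integral (e i)
  have h2 : (k : ℝ) = ∫ x, ∑ i, ‖e i x‖ ^ 2 := by
    rw [integral_finsetSum _ fun i _ => integrable_norm_sq (e i),
      ← Finset.sum_congr rfl fun i _ => h1 i]
    simp [he.norm_eq_one]
  have h3 : ∫ x, ∑ i, ‖e i x‖ ^ 2 ≤ ∫ x : Euc n, Module.finrank ℂ F * C ^ 2 * weight x ^ 2 := by
    refine integral_mono_ae (integrable_finsetSum _ fun i _ => integrable_norm_sq (e i))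
      (integrable_weight_sq.const_mul _) ?_
    have h4 : ∀ᵐ x : Euc n, ∀ i, e i x = G x (e i) := by
      rw [ae_all_iff]
      intro i
      filter_upwards [hK (e i)] with x hx
      rw [hTe i] at hx
      rw [hx, hG]
    filter_upwards [h4] with x hx
    simp_rw [hx]
    refine (sum_norm_sq_le_of_orthonormal e he (G x)).trans ?_
    rw [mul_assoc, ← mul_pow]
    gcongr
    exact hGC x
  exact_mod_cast h2.le.trans (h3.trans hN)

theorem finiteDimensional_range_of_isIdempotentElem {T : L2 n F →L[ℂ] L2 n F}
    (hT : IsSchwartzKernelOperator T) (hid : IsIdempotentElem T) :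
    FiniteDimensional ℂ (LinearMap.range (T : L2 n F →ₗ[ℂ] L2 n F)) := by
  obtain ⟨N, hN⟩ := exists_card_bound_of_orthonormal hT
  have hfix : ∀ r ∈ LinearMap.range (T : L2 n F →ₗ[ℂ] L2 n F), T r = r := by
    rintro _ ⟨f, rfl⟩
    exact DFunLike.congr_fun hid f
  have hrank : Module.rank ℂ (LinearMap.range (T : L2 n F →ₗ[ℂ] L2 n F)) ≤ N := by
    refine rank_le fun s hs => ?_
    let S := Submodule.span ℂ
      (Set.range fun i : s => (i : LinearMap.range (T : L2 n F →ₗ[ℂ] L2 n F)))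
    have hfin : FiniteDimensional ℂ S := FiniteDimensional.span_of_finite ℂ (Set.finite_range _)
    have hcard : Module.finrank ℂ S = s.card := by
      rw [finrank_span_eq_card hs, Fintype.card_coe]
    rw [← hcard]
    refine hN _ (fun i => ((stdOrthonormalBasis ℂ S i :
      LinearMap.range (T : L2 n F →ₗ[ℂ] L2 n F)) : L2 n F)) ?_ fun i => hfix _ (Subtype.prop _)
    exact ((stdOrthonormalBasis ℂ S).orthonormal.comp_linearIsometry S.subtypeₗᵢ).comp_linearIsometry
      (Submodule.subtypeₗᵢ _)
  exact Module.rank_lt_aleph0_iff.1 (hrank.trans_lt (Cardinal.natCast_lt_aleph0))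

end KernelOperator

/-! ### Bounded commutators with derivatives and coordinates -/

section Commutators

variable {n : ℕ} {F : Type*} [NormedAddCommGroup F] [InnerProductSpace ℂ F]

theorem toLp_ext {φ ψ : 𝓢(Euc n, F)} (h : φ.toLp 2 volume = ψ.toLp 2 volume) : φ = ψ :=
  SchwartzMap.injective_toLp 2 volume h

theorem toLp_sub (φ ψ : 𝓢(Euc n, F)) :
    (φ - ψ).toLp 2 volume = φ.toLp 2 volume - ψ.toLp 2 volume :=
  map_sub (SchwartzMap.toLpCLM ℂ F 2 volume) φ ψ

/-- Precomposing a kernel operator with `D` gives a kernel operator. -/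
def HasKernelTranspose (D : 𝓢(Euc n, F) →L[ℂ] 𝓢(Euc n, F)) : Prop :=
  ∀ K : 𝓢(Euc n × Euc n, F →L[ℝ] F), ∃ K' : 𝓢(Euc n × Euc n, F →L[ℝ] F),
    ∀ (φ : 𝓢(Euc n, F)) x, ∫ y, K (x, y) (D φ y) = ∫ y, K' (x, y) (φ y)

/-- Integration by parts in the second variable; hence the kernel `-K'`. -/
theorem hasKernelTranspose_partialOp (v : Euc n) :
    HasKernelTranspose (partialOp v : 𝓢(Euc n, F) →L[ℂ] 𝓢(Euc n, F)) := by
  intro K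
  obtain ⟨K', hK'⟩ : ∃ K' : 𝓢(Euc n × Euc n, F →L[ℝ] F), ∀ p, K' p = fderiv ℝ K p (0, v) :=
    ⟨∂_{((0, v) : Euc n × Euc n)} K, fun _ => rfl⟩
  obtain ⟨φ', hφ'⟩ : ∃ φ' : 𝓢(Euc n, F) → 𝓢(Euc n, F), (∀ φ y, φ' φ y = fderiv ℝ φ y v) ∧
      ∀ φ, partialOp v φ = φ' φ := ⟨fun φ => partialOp v φ, fun _ _ => rfl, fun _ => rfl⟩
  refine ⟨-K', fun φ x => ?_⟩
  rw [hφ'.2]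
  have hint : ∀ (K : 𝓢(Euc n × Euc n, F →L[ℝ] F)) (φ : 𝓢(Euc n, F)),
      Integrable fun y => K (x, y) (φ y) := by
    intro K φ
    refine (integrable_kernel_apply K (φ.toLp 2 volume) x).congr ?_
    filter_upwards [φ.coeFn_toLp 2 volume] with y hy
    rw [hy]
  have h := integral_bilinear_hasLineDerivAt_right_eq_neg_left_of_integrable (μ := volume)
    (B := ContinuousLinearMap.id ℝ (F →L[ℝ] F)) (v := v) (f := fun y => K (x, y))
    (f' := fun y => K' (x, y)) (g := φ) (g' := φ' φ)
    (hint _ _) (hint _ _) (hint _ _) (fun y _ => ?_) fun y _ => ?_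
  · refine h.trans ?_
    rw [← integral_neg]
    rfl
  · have h1 : HasFDerivAt (fun y => K (x, y))
        ((fderiv ℝ K (x, y)).comp (ContinuousLinearMap.inr ℝ (Euc n) (Euc n))) y :=
      (K.hasFDerivAt (x, y)).comp y (hasFDerivAt_prodMk_right x y)
    rw [hK']
    exact h1.hasLineDerivAt v
  · rw [hφ'.1]
    exact (φ.hasFDerivAt y).hasLineDerivAt v

theorem hasKernelTranspose_coordOp (v : Euc n) :
    HasKernelTranspose (coordOp v : 𝓢(Euc n, F) →L[ℂ] 𝓢(Euc n, F)) := by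
  intro K
  refine ⟨SchwartzMap.smulLeftCLM (F →L[ℝ] F) (fun p : Euc n × Euc n => ⟪v, p.2⟫_ℝ) K,
    fun φ x => integral_congr_ae (Filter.Eventually.of_forall fun y => ?_)⟩
  have hg : Function.HasTemperateGrowth fun p : Euc n × Euc n => ⟪v, p.2⟫_ℝ :=
    ((innerSL ℝ v).comp (ContinuousLinearMap.snd ℝ (Euc n) (Euc n))).hasTemperateGrowth
  dsimp only
  rw [SchwartzMap.smulLeftCLM_apply_apply hg, coordOp_apply, Complex.coe_smul, map_smul]
  rfl

theorem partialOp_comm (v w : Euc n) (φ : 𝓢(Euc n, F)) :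
    partialOp v (partialOp w φ) = partialOp w (partialOp v φ) := by
  have h : ∀ (u : Euc n) (ψ : 𝓢(Euc n, F)) x, partialOp u ψ x = fderiv ℝ ψ x u := fun _ _ _ => rfl
  have h2 : ∀ (a b : Euc n) x, partialOp a (partialOp b φ) x = fderiv ℝ (fderiv ℝ φ) x a b := by
    intro a b x
    rw [h]
    have h3 : HasFDerivAt (fun y => fderiv ℝ φ y b)
        ((ContinuousLinearMap.apply ℝ F b).comp (fderiv ℝ (fderiv ℝ φ) x)) x :=
      (ContinuousLinearMap.apply ℝ F b).hasFDerivAt.comp x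
        (SchwartzMap.fderivCLM ℝ (Euc n) F φ).differentiableAt.hasFDerivAt
    have h4 : (partialOp b φ : Euc n → F) = fun y => fderiv ℝ φ y b := rfl
    rw [h4, h3.fderiv]
    rfl
  ext x
  rw [h2, h2]
  have hs : IsSymmSndFDerivAt ℝ φ x :=
    (φ.smooth 2).contDiffAt.isSymmSndFDerivAt (by simp)
  exact hs.eq v w

theorem coordOp_comm (v w : Euc n) (φ : 𝓢(Euc n, F)) :
    coordOp v (coordOp w φ) = coordOp w (coordOp v φ) := by
  ext x
  simp only [coordOp_apply]
  exact smul_comm _ _ _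

theorem partialOp_coordOp (v w : Euc n) (φ : 𝓢(Euc n, F)) :
    partialOp v (coordOp w φ) - coordOp w (partialOp v φ) = ((⟪w, v⟫_ℝ : ℝ) : ℂ) • φ := by
  ext x
  have h1 : (coordOp w φ : Euc n → F) = fun y => ⟪w, y⟫_ℝ • φ y := by
    funext y
    rw [coordOp_apply, Complex.coe_smul]
  have h2 : HasFDerivAt (fun y => ⟪w, y⟫_ℝ • φ y)
      (⟪w, x⟫_ℝ • fderiv ℝ φ x + (innerSL ℝ w).smulRight (φ x)) x :=
    (innerSL ℝ w).hasFDerivAt.smul (φ.hasFDerivAt x)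
  have h3 : partialOp v (coordOp w φ) x = fderiv ℝ (coordOp w φ) x v := rfl
  have h4 : partialOp v φ x = fderiv ℝ φ x v := rfl
  rw [sub_apply, smul_apply, coordOp_apply, h3, h1, h2.fderiv, h4]
  simp

variable {T : L2 n F →L[ℂ] L2 n F} {σ : L2 n F →ₗ[ℂ] 𝓢(Euc n, F)}

theorem schwartzLift_apply_self (hid : IsIdempotentElem T)
    (hσ : ∀ f, (σ f).toLp 2 volume = T f) (f : L2 n F) : σ (T f) = σ f := by
  apply toLp_ext
  rw [hσ, hσ]
  exact DFunLike.congr_fun hid f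

theorem exists_schwartzLift_eq_integral (hT : IsSchwartzKernelOperator T)
    (hσ : ∀ f, (σ f).toLp 2 volume = T f) :
    ∃ K : 𝓢(Euc n × Euc n, F →L[ℝ] F), ∀ f x, σ f x = ∫ y, K (x, y) (f y) := by
  obtain ⟨K, hK⟩ := hT
  refine ⟨realKernel K, fun f x => ?_⟩
  obtain ⟨ψ, hψ⟩ := exists_schwartz_eq_integral_kernel (realKernel K) f
  rw [← hψ]
  have h : σ f = ψ := by
    apply toLp_ext
    rw [hσ]
    refine Lp.ext ?_
    filter_upwards [hK f, ψ.coeFn_toLp 2 volume] with x h1 h2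
    rw [h1]
    exact (h2.trans (hψ x)).symm
  rw [h]

variable [FiniteDimensional ℂ F] [CompleteSpace F]

/-- `D T` factors through the finite-dimensional range of `T`, where every linear map is continuous.
-/
theorem exists_diffOp_comp (hT : IsSchwartzKernelOperator T) (hid : IsIdempotentElem T)
    (hσ : ∀ f, (σ f).toLp 2 volume = T f) (D : 𝓢(Euc n, F) →L[ℂ] 𝓢(Euc n, F)) :
    ∃ P : L2 n F →L[ℂ] L2 n F, ∀ f, P f = (D (σ f)).toLp 2 volume := by
  have hfin := finiteDimensional_range_of_isIdempotentElem hT hid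
  let R := LinearMap.range (T : L2 n F →ₗ[ℂ] L2 n F)
  let P : R →ₗ[ℂ] L2 n F :=
    (SchwartzMap.toLpCLM ℂ F 2 volume).toLinearMap ∘ₗ D.toLinearMap ∘ₗ σ ∘ₗ R.subtype
  refine ⟨(LinearMap.toContinuousLinearMap P).comp (T.codRestrict R fun f => ⟨f, rfl⟩),
    fun f => ?_⟩
  change (D (σ (T f))).toLp 2 volume = _
  rw [schwartzLift_apply_self hid hσ]

/-- Moving `D` onto the kernel bounds `T D φ` in sup norm by the `L²` norm of `φ`. On the
finite-dimensional range the sup norm controls the `L²` norm, so `T D` extends from the dense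
Schwartz space. -/
theorem exists_comp_diffOp (hT : IsSchwartzKernelOperator T) (hid : IsIdempotentElem T)
    (hσ : ∀ f, (σ f).toLp 2 volume = T f) {D : 𝓢(Euc n, F) →L[ℂ] 𝓢(Euc n, F)}
    (hD : HasKernelTranspose D) :
    ∃ Q : L2 n F →L[ℂ] L2 n F, ∀ φ : 𝓢(Euc n, F),
      Q (φ.toLp 2 volume) = T ((D φ).toLp 2 volume) := by
  have hfin := finiteDimensional_range_of_isIdempotentElem hT hid
  let R := LinearMap.range (T : L2 n F →ₗ[ℂ] L2 n F)
  let j : R →ₗ[ℂ] BoundedContinuousFunction (Euc n) F :=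
    (SchwartzMap.toBoundedContinuousFunctionCLM ℂ (Euc n) F).toLinearMap ∘ₗ σ ∘ₗ R.subtype
  have hj : ∀ r : R, ∀ x, j r x = σ r x := fun _ _ => rfl
  have hker : LinearMap.ker j = ⊥ := by
    rw [LinearMap.ker_eq_bot']
    rintro ⟨_, f, rfl⟩ hr
    have h1 : σ (T f) = 0 := by
      ext x
      exact DFunLike.congr_fun hr x
    rw [schwartzLift_apply_self hid hσ] at h1
    refine Subtype.ext ?_
    change T f = 0
    rw [← hσ, h1]
    exact map_zero (SchwartzMap.toLpCLM ℂ F 2 volume)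
  obtain ⟨c, -, hc⟩ := j.exists_antilipschitzWith hker
  obtain ⟨K, hK⟩ := exists_schwartzLift_eq_integral hT hσ
  obtain ⟨K', hK'⟩ := hD K
  obtain ⟨C, hC, hbound⟩ := exists_norm_integral_kernel_le K' 0
  let ι := (SchwartzMap.toLpCLM ℂ F 2 (volume : Measure (Euc n))).toLinearMap
  let f : 𝓢(Euc n, F) →ₗ[ℂ] L2 n F := (T : L2 n F →ₗ[ℂ] L2 n F) ∘ₗ ι ∘ₗ D.toLinearMap
  have hdense : DenseRange ι :=
    SchwartzMap.denseRange_toLpCLM (F := F) (μ := (volume : Measure (Euc n))) (p := 2) (by norm_num)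
  refine ⟨f.extendOfNorm ι, fun φ => LinearMap.extendOfNorm_eq hdense ⟨c * C, fun φ => ?_⟩ φ⟩
  have h1 := hc.le_mul_dist (⟨f φ, _, rfl⟩ : R) 0
  rw [map_zero, dist_zero_right, dist_zero_right] at h1
  have h2 : ‖j (⟨f φ, _, rfl⟩ : R)‖ ≤ C * ‖ι φ‖ := by
    refine (BoundedContinuousFunction.norm_le (by positivity)).2 fun x => ?_
    rw [hj]
    change ‖σ (T ((D φ).toLp 2 volume)) x‖ ≤ C * ‖φ.toLp 2 volume‖
    rw [schwartzLift_apply_self hid hσ, hK]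
    have h3 : ∫ y, K (x, y) (((D φ).toLp 2 volume : L2 n F) y)
        = ∫ y, K' (x, y) ((φ.toLp 2 volume : L2 n F) y) := by
      have h4 : ∫ y, K (x, y) (((D φ).toLp 2 volume : L2 n F) y) = ∫ y, K (x, y) (D φ y) := by
        refine integral_congr_ae ?_
        filter_upwards [(D φ).coeFn_toLp 2 volume] with y hy
        rw [hy]
      rw [h4, hK']
      refine integral_congr_ae ?_
      filter_upwards [φ.coeFn_toLp 2 volume] with y hy
      rw [hy]
    rw [h3]
    have h5 := hbound (φ.toLp 2 volume) x
    rw [pow_zero, one_mul] at h5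
    refine h5.trans ?_
    gcongr
    exact mul_le_of_le_one_right hC (weight_le_one x)
  calc ‖f φ‖ ≤ c * ‖j (⟨f φ, _, rfl⟩ : R)‖ := h1
    _ ≤ c * (C * ‖ι φ‖) := by gcongr
    _ = c * C * ‖ι φ‖ := by ring

/-- On Schwartz functions `[D, T] φ = D (T φ) - T (D φ)`. -/
theorem commutator_toLp (hT : IsSchwartzKernelOperator T) (hid : IsIdempotentElem T)
    (hσ : ∀ f, (σ f).toLp 2 volume = T f) {D : 𝓢(Euc n, F) →L[ℂ] 𝓢(Euc n, F)}
    (hD : HasKernelTranspose D) (φ : 𝓢(Euc n, F)) :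
    commutator D T (φ.toLp 2 volume)
      = (D (σ (φ.toLp 2 volume))).toLp 2 volume - T ((D φ).toLp 2 volume) := by
  obtain ⟨P, hP⟩ := exists_diffOp_comp hT hid hσ D
  obtain ⟨Q, hQ⟩ := exists_comp_diffOp hT hid hσ hD
  have h : IsCommutator D T (P - Q) := by
    intro φ
    refine ⟨σ (φ.toLp 2 volume), (hσ _).symm, ?_⟩
    rw [sub_apply, hP, hQ]
  rw [h.commutator_eq, sub_apply, hP, hQ]

/-- `[D', T]` sends `T f` to `s = (1 - T) D' T f`. Since `T s = 0`, `[D, T] s = -T D s`. -/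
theorem commutator_mul_commutator_mul (hT : IsSchwartzKernelOperator T) (hid : IsIdempotentElem T)
    (hσ : ∀ f, (σ f).toLp 2 volume = T f) {D D' : 𝓢(Euc n, F) →L[ℂ] 𝓢(Euc n, F)}
    (hD : HasKernelTranspose D) (hD' : HasKernelTranspose D') (f : L2 n F) :
    commutator D T (commutator D' T (T f))
      = T ((D (σ ((D' (σ f)).toLp 2 volume))).toLp 2 volume)
        - T ((D (D' (σ f))).toLp 2 volume) := by
  have hTT : ∀ f, T (T f) = T f := fun f => DFunLike.congr_fun hid f
  have hσσ : σ ((σ f).toLp 2 volume) = σ f := by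
    rw [hσ, schwartzLift_apply_self hid hσ]
  set s := D' (σ f) - σ ((D' (σ f)).toLp 2 volume) with hs
  have h1 : commutator D' T (T f) = s.toLp 2 volume := by
    rw [← hσ, commutator_toLp hT hid hσ hD', hσσ, hs, toLp_sub, hσ]
  have h2 : σ (s.toLp 2 volume) = 0 := by
    rw [hs, toLp_sub, map_sub, hσ, schwartzLift_apply_self hid hσ, sub_self]
  have h3 : (0 : 𝓢(Euc n, F)).toLp 2 (volume : Measure (Euc n)) = 0 :=
    map_zero (SchwartzMap.toLpCLM ℂ F 2 volume)
  rw [h1, commutator_toLp hT hid hσ hD, h2, map_zero, h3, hs, map_sub, toLp_sub, map_sub]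
  abel

end Commutators

/-! ### Traces on the range of an idempotent -/

section Trace

variable {H : Type*} [NormedAddCommGroup H] [InnerProductSpace ℂ H]

/-- The trace of the compression of `X` to the range of the idempotent `T`. -/
noncomputable def compressedTrace (T : H →L[ℂ] H) : (H →L[ℂ] H) →ₗ[ℂ] ℂ where
  toFun X := LinearMap.trace ℂ (LinearMap.range (T : H →ₗ[ℂ] H))
    ((T : H →ₗ[ℂ] H).rangeRestrict ∘ₗ (X : H →ₗ[ℂ] H) ∘ₗ
      (LinearMap.range (T : H →ₗ[ℂ] H)).subtype)
  map_add' X Y := by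
    rw [← map_add]
    congr 1
    ext x
    simp
  map_smul' c X := by
    rw [RingHom.id_apply, ← map_smul]
    congr 1
    ext x
    simp

theorem compressedTrace_apply (T X : H →L[ℂ] H) :
    compressedTrace T X = LinearMap.trace ℂ (LinearMap.range (T : H →ₗ[ℂ] H))
      ((T : H →ₗ[ℂ] H).rangeRestrict ∘ₗ (X : H →ₗ[ℂ] H) ∘ₗ
        (LinearMap.range (T : H →ₗ[ℂ] H)).subtype) := rfl

theorem compressedTrace_mul_self {T : H →L[ℂ] H} (hid : IsIdempotentElem T) (X : H →L[ℂ] H) :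
    compressedTrace T (X * T) = compressedTrace T X := by
  rw [compressedTrace_apply, compressedTrace_apply]
  congr 1
  ext ⟨_, f, rfl⟩
  have h : T (T f) = T f := DFunLike.congr_fun hid f
  simp [h]

theorem compressedTrace_mul_comm {T A : H →L[ℂ] H} (hTA : T * A = A)
    (hAT : A * T = A) (X : H →L[ℂ] H) : compressedTrace T (A * X) = compressedTrace T (X * A) := by
  rw [compressedTrace_apply, compressedTrace_apply]
  let p := (T : H →ₗ[ℂ] H).rangeRestrict
  let i := (LinearMap.range (T : H →ₗ[ℂ] H)).subtype
  have h1 : p ∘ₗ ((A * X : H →L[ℂ] H) : H →ₗ[ℂ] H) ∘ₗ i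
      = (p ∘ₗ (A : H →ₗ[ℂ] H) ∘ₗ i) * (p ∘ₗ (X : H →ₗ[ℂ] H) ∘ₗ i) := by
    ext f
    exact congrArg T (DFunLike.congr_fun hAT (X f)).symm
  have h2 : p ∘ₗ ((X * A : H →L[ℂ] H) : H →ₗ[ℂ] H) ∘ₗ i
      = (p ∘ₗ (X : H →ₗ[ℂ] H) ∘ₗ i) * (p ∘ₗ (A : H →ₗ[ℂ] H) ∘ₗ i) := by
    ext f
    exact congrArg (fun y => T (X y)) (DFunLike.congr_fun hTA (f : H)).symm
  change LinearMap.trace ℂ _ (p ∘ₗ _ ∘ₗ i) = LinearMap.trace ℂ _ (p ∘ₗ _ ∘ₗ i)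
  rw [h1, h2, LinearMap.trace_mul_comm]

/-- The range of `B` lies in that of `T`, so an orthonormal basis `b` of the latter gives the finite
nuclear expansion `B = ∑ ⟨B* b_k, ·⟩ b_k`. -/
theorem opTrace_eq_compressedTrace [CompleteSpace H] {T B : H →L[ℂ] H}
    [FiniteDimensional ℂ (LinearMap.range (T : H →ₗ[ℂ] H))] (hB : T * B = B) :
    opTrace B = compressedTrace T B := by
  let R := LinearMap.range (T : H →ₗ[ℂ] H)
  let b := stdOrthonormalBasis ℂ R
  -- Nuclear expansions are indexed by `ℕ`, so the finite one is padded with zeros.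
  let a' : ℕ → H := Function.extend Fin.val (fun k => ContinuousLinearMap.adjoint B (b k)) 0
  let b' : ℕ → H := Function.extend Fin.val (fun k => (b k : H)) 0
  have hinj := Fin.val_injective (n := Module.finrank ℂ R)
  have ha : ∀ k : Fin (Module.finrank ℂ R), a' k = ContinuousLinearMap.adjoint B (b k) :=
    fun k => hinj.extend_apply _ _ _
  have hb : ∀ k : Fin (Module.finrank ℂ R), b' k = b k := fun k => hinj.extend_apply _ _ _
  have hb0 : ∀ k, k ∉ Set.range (Fin.val : Fin (Module.finrank ℂ R) → ℕ) → b' k = 0 :=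
    fun k hk => Function.extend_apply' _ _ _ hk
  have hsum : Summable fun k => ‖a' k‖ * ‖b' k‖ := by
    rw [← hinj.summable_iff fun k hk => by rw [hb0 k hk, norm_zero, mul_zero]]
    exact Summable.of_finite
  have hval : ∀ x, HasSum (fun k => ⟪a' k, x⟫_ℂ • b' k) (B x) := by
    intro x
    rw [← hinj.hasSum_iff fun k hk => by rw [hb0 k hk, smul_zero]]
    have h1 := b.sum_repr' ⟨B x, B x, DFunLike.congr_fun hB x⟩
    convert! hasSum_fintype _ using 1
    refine (congrArg Subtype.val h1).symm.trans ?_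
    rw [Submodule.coe_sum]
    refine Finset.sum_congr rfl fun i _ => ?_
    rw [Function.comp_apply, ha, hb, ContinuousLinearMap.adjoint_inner_left]
    rfl
  have h := hasSum_trace_of_nuclear hsum hval
    (exists_hilbertBasis ℂ H).choose_spec.choose
  have h2 : HasSum (fun k => ⟪a' k, b' k⟫_ℂ) (∑ i, ⟪(b i : H), B (b i)⟫_ℂ) := by
    rw [← hinj.hasSum_iff fun k hk => by rw [hb0 k hk, inner_zero_right]]
    convert! hasSum_fintype _ using 1
    refine Finset.sum_congr rfl fun i _ => ?_
    rw [Function.comp_apply, ha, hb, ContinuousLinearMap.adjoint_inner_left]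
  rw [opTrace, h.tsum_eq, compressedTrace_apply, LinearMap.trace_eq_sum_inner _ b, h2.tsum_eq]
  refine Finset.sum_congr rfl fun i _ => ?_
  exact congrArg (fun y => ⟪(b i : H), y⟫_ℂ) (DFunLike.congr_fun hB (b i : H)).symm

end Trace

/-! ### Equivariance, canonical commutation relations and the value of the cocycle -/

section Action

variable {n : ℕ} {F : Type*} [NormedAddCommGroup F] [InnerProductSpace ℂ F]

/-- The operator `(ĝ φ)(x) = h (φ (g⁻¹ x))` on Schwartz functions. -/
noncomputable def schwartzHat (g : Matrix.specialOrthogonalGroup (Fin n) ℝ) (h : F →L[ℂ] F) :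
    𝓢(Euc n, F) →L[ℂ] 𝓢(Euc n, F) :=
  (SchwartzMap.postcompCLM h).comp
    (SchwartzMap.compCLMOfContinuousLinearEquiv ℂ (rotation g).symm.toContinuousLinearEquiv)

theorem schwartzHat_apply (g : Matrix.specialOrthogonalGroup (Fin n) ℝ) (h : F →L[ℂ] F)
    (φ : 𝓢(Euc n, F)) (x : Euc n) : schwartzHat g h φ x = h (φ ((rotation g).symm x)) := rfl

theorem gHat_toLp (g : Matrix.specialOrthogonalGroup (Fin n) ℝ) (h : F →L[ℂ] F)
    (φ : 𝓢(Euc n, F)) :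
    gHat g h (φ.toLp 2 volume) = (schwartzHat g h φ).toLp 2 volume := by
  refine Lp.ext ?_
  filter_upwards [gHat_ae_eq g h (φ.toLp 2 volume), (schwartzHat g h φ).coeFn_toLp 2 volume,
    (rotation g).symm.measurePreserving.quasiMeasurePreserving.ae (φ.coeFn_toLp 2 volume)]
    with x h1 h2 h3
  rw [h1, h2, h3, schwartzHat_apply]

theorem rotation_symm_of_mem_fixedSpace {g : Matrix.specialOrthogonalGroup (Fin n) ℝ}
    {v : Euc n} (hv : v ∈ fixedSpace g) : (rotation g).symm v = v := by
  rw [LinearIsometryEquiv.symm_apply_eq]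
  exact (show rotation g v = v from hv).symm

theorem schwartzHat_partialOp {g : Matrix.specialOrthogonalGroup (Fin n) ℝ} (h : F →L[ℂ] F)
    {v : Euc n} (hv : v ∈ fixedSpace g) (φ : 𝓢(Euc n, F)) :
    schwartzHat g h (partialOp v φ) = partialOp v (schwartzHat g h φ) := by
  ext x
  have h1 : ∀ (ψ : 𝓢(Euc n, F)) x, partialOp v ψ x = fderiv ℝ ψ x v := fun _ _ => rfl
  have h2 : HasFDerivAt (schwartzHat g h φ) (((h.restrictScalars ℝ).comp
      (fderiv ℝ φ ((rotation g).symm x))).comp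
      ((rotation g).symm.toContinuousLinearEquiv : Euc n →L[ℝ] Euc n)) x :=
    ((h.restrictScalars ℝ).hasFDerivAt.comp _ (φ.hasFDerivAt _)).comp x
      ((rotation g).symm.toContinuousLinearEquiv : Euc n →L[ℝ] Euc n).hasFDerivAt
  rw [schwartzHat_apply, h1, h1, h2.fderiv]
  change _ = h (fderiv ℝ φ ((rotation g).symm x) ((rotation g).symm v))
  rw [rotation_symm_of_mem_fixedSpace hv]

theorem schwartzHat_coordOp {g : Matrix.specialOrthogonalGroup (Fin n) ℝ} (h : F →L[ℂ] F)
    {v : Euc n} (hv : v ∈ fixedSpace g) (φ : 𝓢(Euc n, F)) :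
    schwartzHat g h (coordOp v φ) = coordOp v (schwartzHat g h φ) := by
  ext x
  have h1 : ⟪v, (rotation g).symm x⟫_ℝ = ⟪v, x⟫_ℝ := by
    nth_rw 1 [← rotation_symm_of_mem_fixedSpace hv]
    exact LinearIsometryEquiv.inner_map_map _ _ _
  rw [schwartzHat_apply, coordOp_apply, coordOp_apply, schwartzHat_apply, h1, map_smul]

/-- The operators `D_{2j} = ∂_{v_j}` and `D_{2j+1} = ⟨v_j, x⟩`. -/
noncomputable def canonicalOp {m : ℕ} (v : Fin m → Euc n) (i : Fin (2 * m)) :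
    𝓢(Euc n, F) →L[ℂ] 𝓢(Euc n, F) :=
  if (i : ℕ) % 2 = 0 then partialOp (v ⟨(i : ℕ) / 2, by omega⟩)
  else coordOp (v ⟨(i : ℕ) / 2, by omega⟩)

theorem delta_eq_commutator {m : ℕ} (v : Fin m → Euc n) (i : Fin (2 * m))
    (S : L2 n F →L[ℂ] L2 n F) : delta v i S = commutator (canonicalOp v i) S := by
  unfold delta canonicalOp
  split_ifs <;> rfl

theorem hasKernelTranspose_canonicalOp {m : ℕ} (v : Fin m → Euc n) (i : Fin (2 * m)) :
    HasKernelTranspose (canonicalOp v i : 𝓢(Euc n, F) →L[ℂ] 𝓢(Euc n, F)) := by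
  unfold canonicalOp
  split_ifs
  · exact hasKernelTranspose_partialOp _
  · exact hasKernelTranspose_coordOp _

theorem schwartzHat_canonicalOp {g : Matrix.specialOrthogonalGroup (Fin n) ℝ} (h : F →L[ℂ] F)
    {m : ℕ} {v : Fin m → Euc n} (hv : ∀ j, v j ∈ fixedSpace g) (i : Fin (2 * m))
    (φ : 𝓢(Euc n, F)) :
    schwartzHat g h (canonicalOp v i φ) = canonicalOp v i (schwartzHat g h φ) := by
  unfold canonicalOp
  split_ifs
  · exact schwartzHat_partialOp h (hv _) φ
  · exact schwartzHat_coordOp h (hv _) φ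

theorem canonicalOp_commutator {m : ℕ} {v : Fin m → Euc n} (hv : Orthonormal ℝ v)
    (a b : Fin (2 * m)) (φ : 𝓢(Euc n, F)) :
    canonicalOp v a (canonicalOp v b φ) - canonicalOp v b (canonicalOp v a φ)
      = heisenbergForm a b • φ := by
  have hinner := orthonormal_iff_ite.1 hv
  unfold canonicalOp heisenbergForm
  by_cases ha : (a : ℕ) % 2 = 0 <;> by_cases hb : (b : ℕ) % 2 = 0
  · rw [if_pos ha, if_pos hb, partialOp_comm, sub_self, if_neg (by omega), if_neg (by omega),
      zero_smul]
  · rw [if_pos ha, if_neg hb, partialOp_coordOp, hinner,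
      if_neg (c := (b : ℕ) % 2 = 0 ∧ _) (by omega)]
    congr 1
    rw [apply_ite (fun r : ℝ => (r : ℂ)), Complex.ofReal_one, Complex.ofReal_zero]
    refine if_congr ?_ rfl rfl
    rw [Fin.mk.injEq]
    omega
  · rw [if_neg ha, if_pos hb, ← neg_sub, partialOp_coordOp, hinner, ← neg_smul,
      if_neg (c := (a : ℕ) % 2 = 0 ∧ _) (by omega)]
    congr 1
    rw [apply_ite (fun r : ℝ => (r : ℂ)), Complex.ofReal_one, Complex.ofReal_zero,
      apply_ite Neg.neg, neg_zero]
    refine if_congr ?_ rfl rfl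
    rw [Fin.mk.injEq]
    omega
  · rw [if_neg ha, if_neg hb, coordOp_comm, sub_self, if_neg (by omega), if_neg (by omega),
      zero_smul]

variable [FiniteDimensional ℂ F] [CompleteSpace F]

/-- The analytic facts supply the hypotheses of `sum_sign_trace_prod`. -/
theorem omega_of_isIdempotentElem (g : Matrix.specialOrthogonalGroup (Fin n) ℝ) (h : F →L[ℂ] F)
    {m : ℕ} (v : OrthonormalBasis (Fin m) ℝ (fixedSpace g)) (T : invariantKernelOps g h)
    (hid : IsIdempotentElem T.1) :
    omega g h v (fun _ => T) = opTrace (gHat g h * T.1) := by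
  obtain ⟨T, hT, hcomm⟩ := T
  dsimp only at hid
  obtain ⟨σ, hσ⟩ := exists_schwartzLift hT
  have hfin := finiteDimensional_range_of_isIdempotentElem hT hid
  have hTT : ∀ f, T (T f) = T f := fun f => DFunLike.congr_fun hid f
  let w : Fin m → Euc n := fun j => v j
  have hwo : Orthonormal ℝ w := v.orthonormal.comp_linearIsometry (fixedSpace g).subtypeₗᵢ
  let D : Fin (2 * m) → 𝓢(Euc n, F) →L[ℂ] 𝓢(Euc n, F) := canonicalOp w
  have hD : ∀ a, HasKernelTranspose (D a) := hasKernelTranspose_canonicalOp w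
  choose P hP using exists_diffOp_comp hT hid hσ
  have hTσ : ∀ φ : 𝓢(Euc n, F), σ (T (φ.toLp 2 volume)) = σ (φ.toLp 2 volume) :=
    fun φ => schwartzLift_apply_self hid hσ _
  have hgσ : ∀ f, σ (gHat g h f) = schwartzHat g h (σ f) := by
    intro f
    apply toLp_ext
    rw [hσ, ← gHat_toLp, hσ]
    exact (DFunLike.congr_fun hcomm f).symm
  have htrace : ∀ X, opTrace (gHat g h * T * X) = compressedTrace T (gHat g h * T * X) := by
    intro X
    apply opTrace_eq_compressedTrace
    rw [hcomm, ← mul_assoc, ← mul_assoc, hid.eq]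
  -- `P D` is the bounded operator `D T`, so `T * P (D a)` is `T D_a T`.
  have key := sum_sign_trace_prod T (gHat g h) (fun a => commutator (D a) T)
    (fun a => T * P (D a)) (fun a b => T * P ((D a).comp (D b))) (compressedTrace T)
    (fun a => by rw [← mul_assoc, hid.eq])
    (fun a => by
      ext1 f
      simp only [mul_apply_eq_comp, hP, schwartzLift_apply_self hid hσ])
    (fun a => by
      rw [← mul_assoc, hcomm, mul_assoc, mul_assoc]
      congr 1
      ext1 f
      simp only [mul_apply_eq_comp, hP, hgσ, gHat_toLp]
      rw [schwartzHat_canonicalOp h fun j => (v j).2])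
    (fun a b => by
      ext1 f
      simp only [mul_apply_eq_comp, sub_apply, hP, hTσ,
        ContinuousLinearMap.comp_apply]
      exact commutator_mul_commutator_mul hT hid hσ (hD a) (hD b) f)
    (fun a b => by
      ext1 f
      simp only [mul_apply_eq_comp, sub_apply, smul_apply, hP,
        ContinuousLinearMap.comp_apply]
      rw [← map_sub, ← toLp_sub, canonicalOp_commutator hwo]
      change T (SchwartzMap.toLpCLM ℂ F 2 volume _) = _
      rw [map_smul, map_smul, SchwartzMap.toLpCLM_apply, hσ, hTT])
    (compressedTrace_mul_self hid)
    (fun a X => compressedTrace_mul_comm (by rw [← mul_assoc, hid.eq]) (by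
      ext1 f
      simp only [mul_apply_eq_comp, hP, schwartzLift_apply_self hid hσ]) X)
  rw [omega]
  simp only [htrace, delta_eq_commutator]
  rw [key]
  have h1 := htrace 1
  rw [mul_one] at h1
  rw [h1]
  have hm : (m.factorial : ℂ) ≠ 0 := Nat.cast_ne_zero.2 m.factorial_ne_zero
  field_simp
  -- The sign of `omega` meets the sign of `(-Ω)^m`: `((-1)^m)² = 1`.
  rw [← pow_mul, mul_comm m, pow_mul, neg_one_sq, one_pow, one_mul]

end Action

end TwistedPairing

/-! ### The pairing formula -/

theorem proposition3p6 {n k l : ℕ}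
    (G : Subgroup (Matrix.specialOrthogonalGroup (Fin n) ℝ))
    (hG : IsCompact (G : Set (Matrix.specialOrthogonalGroup (Fin n) ℝ)))
    (ρV : G →* (EuclideanSpace ℂ (Fin k) →L[ℂ] EuclideanSpace ℂ (Fin k)))
    (hρV : Continuous ρV)
    (ρW : G →* (EuclideanSpace ℂ (Fin l) →L[ℂ] EuclideanSpace ℂ (Fin l)))
    (hρW : Continuous ρW)
    (g : G) {m : ℕ} (v : OrthonormalBasis (Fin m) ℝ (fixedSpace g.1)) :
    (∀ T : invariantKernelOps g.1 (ContinuousLinearMap.id ℂ ℂ), IsIdempotentElem T.1 →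
      pairing m (Matrix.of fun _ _ : Fin 1 => T)
          (fun S => (2 * Real.pi * Complex.I) ^ m * (m.factorial : ℂ) *
            omega g.1 (ContinuousLinearMap.id ℂ ℂ) v S)
        = opTrace (gHat g.1 (ContinuousLinearMap.id ℂ ℂ) * T.1)) ∧
    (∀ T : invariantKernelOps g.1 (blockDiag (ρV g) (ρW g)), IsIdempotentElem T.1 →
      pairing m (Matrix.of fun _ _ : Fin 1 => T)
          (fun S => (2 * Real.pi * Complex.I) ^ m * (m.factorial : ℂ) *
            omega g.1 (blockDiag (ρV g) (ρW g)) v S)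
        = opTrace (gHat g.1 (blockDiag (ρV g) (ρW g)) * T.1)) := by
  have hp : (2 * Real.pi * Complex.I) ^ m ≠ 0 := pow_ne_zero _ Complex.two_pi_I_ne_zero
  have hm : (m.factorial : ℂ) ≠ 0 := Nat.cast_ne_zero.2 m.factorial_ne_zero
  -- For a one-by-one matrix the index sum has a single term, and the normalisations cancel.
  have hpair : ∀ {A : Type} (T : A) (φ : (Fin (2 * m + 1) → A) → ℂ),
      pairing m (Matrix.of fun _ _ : Fin 1 => T)
        (fun S => (2 * Real.pi * Complex.I) ^ m * (m.factorial : ℂ) * φ S) = φ fun _ => T := by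
    intro A T φ
    simp only [pairing, Matrix.of_apply, Finset.sum_const, Finset.card_univ, Fintype.card_pi_const,
      Fintype.card_fin, one_pow, one_smul]
    field_simp
  refine ⟨fun T hT => ?_, fun T hT => ?_⟩
  · rw [hpair T (omega g.1 (ContinuousLinearMap.id ℂ ℂ) v)]
    exact omega_of_isIdempotentElem _ _ v T hT
  · rw [hpair T (omega g.1 (blockDiag (ρV g) (ρW g)) v)]
    exact omega_of_isIdempotentElem _ _ v T hT
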